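/- Let $V$ be a finite-dimensional real vector space and let $\mathcal{A}$ be a central hyperplane arrangement in $V$, i.e. a finite set of linear hyperplanes (subspaces of codimension one) of $V$. Let $\mathbf{Ch}(\mathcal{A})$ be the set of chambers of $\mathcal{A}$, i.e. of connected components of $V\setminus\bigcup_{H\in\mathcal{A}}H$, and for $H\in\mathcal{A}$ let $\epsilon_H\colon\mathbf{Ch}(\mathcal{A})\to\mathbf{Ch}(\{H\})$ send a chamber $c$ to the chamber of $\{H\}$ that contains $c$. Let $M_1(\mathcal{A})$ be the simplicial complex whose vertices are the chambers of $\mathcal{A}$ and whose simplices are the nonempty sets $T$ of chambers such that $|\epsilon_H(T)|=1$ for at least one $H\in\mathcal{A}$. Let $r=\dim V-\dim\bigcap_{H\in\mathcal{A}}H$ be the rank of $\mathcal{A}$. Let $f\colon\mathbf{Ch}(\mathcal{A})\to\mathbf{Ch}(\mathcal{A})$ be a map that satisfies IIA, i.e. for every $H\in\mathcal{A}$ there is a map $\phi_H\colon\mathbf{Ch}(\{H\})\to\mathbf{Ch}(\{H\})$ with $\epsilon_H\circ f=\phi_H\circ\epsilon_H$. Then $f$ is a simplicial map of $M_1(\mathcal{A})$;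 let $\tilde f\colon|M_1(\mathcal{A})|\to|M_1(\mathcal{A})|$ be the continuous map that it induces on the geometric realization. The following five conditions are equivalent: (i) $f$ is injective; (ii) for every $H\in\mathcal{A}$, $\phi_H$ is the identity or the map that exchanges the two elements of $\mathbf{Ch}(\{H\})$; (iii) $\tilde f$ is not null-homotopic (not homotopic to a constant map); (iv) $\tilde f$ has degree $1$ or $-1$, i.e. the reduced singular homology group $\tilde H_{r-1}(|M_1(\mathcal{A})|;\mathbb{Z})$ is infinite cyclic and $\tilde f$ acts on it as multiplication by $1$ or by $-1$ (if $\mathcal{A}=\emptyset$, then $r=0$, $|M_1(\mathcal{A})|=\emptyset$, and the only self-map of the empty space has degree $1$ by convention); (v) $\tilde f$ is a homeomorphism. Moreover, if $f$ is injective and has a fixed point, then $f$ is the identity. -/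

import Mathlib

noncomputable section

universe u

/-! ### Central hyperplane arrangements and chambers -/

/-- A real central hyperplane arrangement in `V`: a finite set of linear hyperplanes of `V`,
i.e. of kernels of nonzero linear functionals. -/
structure CentralArrangement (V : Type u) [AddCommGroup V] [Module ℝ V] where
  /-- the hyperplanes of the arrangement -/
  hyperplanes : Finset (Submodule ℝ V)
  isHyperplane : ∀ H ∈ hyperplanes, ∃ α : Module.Dual ℝ V, α ≠ 0 ∧ LinearMap.ker α = H

namespace CentralArrangement

section Algebra

variable {V : Type u} [AddCommGroup V] [Module ℝ V]

/-- The complement `V - ⋃ H` of the hyperplanes. -/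
def complement (A : CentralArrangement V) : Set V :=
  {x | ∀ H ∈ A.hyperplanes, x ∉ H}

/-- The subarrangement `{H}`. -/
def single (A : CentralArrangement V) (H : A.hyperplanes) : CentralArrangement V where
  hyperplanes := {H.1}
  isHyperplane := by
    intro K hK
    rw [Finset.mem_singleton] at hK
    subst hK
    exact A.isHyperplane _ H.2

theorem complement_subset_single (A : CentralArrangement V) (H : A.hyperplanes) :
    A.complement ⊆ (A.single H).complement := by
  intro x hx K hK
  have hK' : K = H.1 := Finset.mem_singleton.1 hK
  subst hK'
  exact hx _ H.2

/-- The rank `dim V - dim ⋂ H`. -/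
def rank (A : CentralArrangement V) : ℕ :=
  Module.finrank ℝ V - Module.finrank ℝ (A.hyperplanes.inf id : Submodule ℝ V)

end Algebra

variable {V : Type u} [AddCommGroup V] [Module ℝ V] [TopologicalSpace V]

/-- `Ch(A)`: the chambers of `A` are the connected components of the complement of the
hyperplanes. -/
def Chamber (A : CentralArrangement V) : Type u :=
  {C : Set V // ∃ x ∈ A.complement, connectedComponentIn A.complement x = C}

namespace Chamber

/-- A point of the chamber. -/
def point {A : CentralArrangement V} (c : A.Chamber) : V := c.2.choose

theorem point_mem_complement {A : CentralArrangement V} (c : A.Chamber) :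
    c.point ∈ A.complement := c.2.choose_spec.1

theorem component_point {A : CentralArrangement V} (c : A.Chamber) :
    connectedComponentIn A.complement c.point = c.1 := c.2.choose_spec.2

end Chamber

/-- `ε_H : Ch(A) → Ch({H})` sends a chamber `c` to the chamber of `{H}` that contains `c`. -/
def eps (A : CentralArrangement V) (H : A.hyperplanes) (c : A.Chamber) : (A.single H).Chamber :=
  ⟨connectedComponentIn (A.single H).complement c.point,
    c.point, A.complement_subset_single H c.point_mem_complement, rfl⟩

/-- `ε_H(c)` contains `c`. -/
theorem subset_eps (A : CentralArrangement V) (H : A.hyperplanes) (c : A.Chamber) :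
    c.1 ⊆ (A.eps H c).1 := by
  rw [← c.component_point]
  exact connectedComponentIn_mono _ (A.complement_subset_single H)

/-- `ε_H(c)` is the only chamber of `{H}` that contains `c`. -/
theorem eq_eps (A : CentralArrangement V) (H : A.hyperplanes) (c : A.Chamber)
    (d : (A.single H).Chamber) (h : c.1 ⊆ d.1) : d = A.eps H c := by
  have hp : c.point ∈ d.1 := by
    apply h
    rw [← c.component_point]
    exact mem_connectedComponentIn c.point_mem_complement
  rw [← d.component_point] at hp
  apply Subtype.ext
  rw [← d.component_point]
  exact connectedComponentIn_eq hp

/-- There are only finitely many chambers. -/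
instance finite_chamber [IsTopologicalAddGroup V] [ContinuousSMul ℝ V]
    (A : CentralArrangement V) : Finite A.Chamber := by
  choose α _ hker using A.isHyperplane
  let s : A.Chamber → A.hyperplanes → Prop := fun c H => 0 < α H.1 H.2 c.point
  refine Finite.of_injective s fun c d hcd => ?_
  have hne : ∀ (x : V), x ∈ A.complement → ∀ H : A.hyperplanes, α H.1 H.2 x ≠ 0 := by
    intro x hx H h0
    apply hx H.1 H.2
    rw [← hker H.1 H.2]
    exact h0
  let S : Set V := ⋂ H : A.hyperplanes,
    (if 0 < α H.1 H.2 c.point then {x | 0 < α H.1 H.2 x} else {x | α H.1 H.2 x < 0})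
  have hconv : Convex ℝ S := by
    refine convex_iInter fun H => ?_
    split_ifs
    · exact convex_halfSpace_gt (α H.1 H.2).isLinear 0
    · exact convex_halfSpace_lt (α H.1 H.2).isLinear 0
  have hsub : S ⊆ A.complement := by
    intro x hx K hK hxK
    have h1 := Set.mem_iInter.1 hx ⟨K, hK⟩
    have h0 : α K hK x = 0 := by
      rw [← hker K hK] at hxK
      exact hxK
    split_ifs at h1
    · exact absurd h0 (ne_of_gt h1)
    · exact absurd h0 (ne_of_lt h1)
  have hmem : ∀ e : A.Chamber, s c = s e → e.point ∈ S := by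
    intro e he
    refine Set.mem_iInter.2 fun H => ?_
    have hiff : 0 < α H.1 H.2 c.point ↔ 0 < α H.1 H.2 e.point := iff_of_eq (congrFun he H)
    split_ifs with h
    · exact hiff.1 h
    · exact lt_of_le_of_ne (not_lt.1 (fun h' => h (hiff.2 h')))
        (hne _ e.point_mem_complement H)
  have key := hconv.isPreconnected.subset_connectedComponentIn (hmem c rfl) hsub
  apply Subtype.ext
  rw [← c.component_point, ← d.component_point]
  exact connectedComponentIn_eq (key (hmem d hcd))

instance fintype_chamber [IsTopologicalAddGroup V] [ContinuousSMul ℝ V]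
    (A : CentralArrangement V) : Fintype A.Chamber := Fintype.ofFinite _

/-! ### Independence of irrelevant alternatives -/

/-- `φ : Ch({H}) → Ch({H})` makes the square `ε_H ∘ f = φ ∘ ε_H` commute. -/
def Intertwines (A : CentralArrangement V) (f : A.Chamber → A.Chamber) (H : A.hyperplanes)
    (φ : (A.single H).Chamber → (A.single H).Chamber) : Prop :=
  ∀ c, A.eps H (f c) = φ (A.eps H c)

/-- `f : Ch(A) → Ch(A)` satisfies IIA. -/
def IIA (A : CentralArrangement V) (f : A.Chamber → A.Chamber) : Prop :=
  ∀ H : A.hyperplanes, ∃ φ : (A.single H).Chamber → (A.single H).Chamber, A.Intertwines f H φ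

end CentralArrangement

/-- `φ` exchanges the two elements of the two-element type `X`. -/
def IsSwap {X : Type u} (φ : X → X) : Prop :=
  ∃ a b : X, a ≠ b ∧ (∀ x, x = a ∨ x = b) ∧ φ a = b ∧ φ b = a

/-! ### Geometric realization of finite simplicial complexes -/

section Realization

variable {ι κ : Type u} [Fintype ι] [Fintype κ]

/-- The geometric realization `|K|` of an abstract simplicial complex `K` on a finite set `ι`:
the points of the standard simplex on `ι` (barycentric coordinates) that are supported in a face
of `K`, with the subspace topology. -/
def Realization (K : PreAbstractSimplicialComplex ι) : Type u :=
  {w : stdSimplex ℝ ι // ∃ s ∈ K.faces, ∀ i, i ∉ s → w i = 0}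

instance (K : PreAbstractSimplicialComplex ι) : TopologicalSpace (Realization K) :=
  inferInstanceAs (TopologicalSpace {w : stdSimplex ℝ ι // ∃ s ∈ K.faces, ∀ i, i ∉ s → w i = 0})

/-- The vertex map `f` is simplicial from `K` to `L`: the image of a face is a face. -/
def IsSimplicial (K : PreAbstractSimplicialComplex ι) (L : PreAbstractSimplicialComplex κ)
    (f : ι → κ) : Prop :=
  ∀ s ∈ K.faces, ∃ t ∈ L.faces, (t : Set κ) = f '' s

theorem IsSimplicial.map_mem {K : PreAbstractSimplicialComplex ι}
    {L : PreAbstractSimplicialComplex κ} {f : ι → κ} (hf : IsSimplicial K L f)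
    (w : Realization K) : ∃ t ∈ L.faces, ∀ j, j ∉ t → stdSimplex.map f w.1 j = 0 := by
  classical
  obtain ⟨s, hs, hw⟩ := w.2
  obtain ⟨t, ht, hts⟩ := hf s hs
  refine ⟨t, ht, fun j hj => ?_⟩
  rw [stdSimplex.map_coe, FunOnFinite.linearMap_apply_apply]
  refine Finset.sum_eq_zero fun i hi => hw i fun his => hj ?_
  rw [← Finset.mem_coe, hts]
  exact ⟨i, his, (Finset.mem_filter.1 hi).2⟩

/-- The continuous map `|K| → |L|` that a simplicial vertex map induces: the extension of `f`
that is affine on every simplex. -/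
def IsSimplicial.realize {K : PreAbstractSimplicialComplex ι}
    {L : PreAbstractSimplicialComplex κ} {f : ι → κ} (hf : IsSimplicial K L f) :
    C(Realization K, Realization L) where
  toFun w := ⟨stdSimplex.map f w.1, hf.map_mem w⟩
  continuous_toFun :=
    ((stdSimplex.continuous_map f).comp continuous_subtype_val).subtype_mk _

end Realization

/-! ### The complex `M₁(A)` -/

namespace CentralArrangement

variable {V : Type u} [AddCommGroup V] [Module ℝ V] [TopologicalSpace V]

/-- `H` separates the set `T` of chambers: `ε_H(T)` has at least two elements. -/
def Separates (A : CentralArrangement V) (H : A.hyperplanes) (T : Set A.Chamber) : Prop :=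
  (A.eps H '' T).Nontrivial

/-- The simplicial complex `M₁(A)`: its vertices are the chambers of `A`, and a nonempty set `T`
of chambers is a simplex when some hyperplane of `A` does not separate `T`. -/
def M (A : CentralArrangement V) : PreAbstractSimplicialComplex A.Chamber where
  faces := {T | T.Nonempty ∧ ∃ H : A.hyperplanes, ¬ A.Separates H (T : Set A.Chamber)}
  isRelLowerSet_faces := by
    rintro T ⟨hT, H, hH⟩
    refine ⟨hT, fun T' hT' hne => ⟨hne, H, fun h => hH ?_⟩⟩
    exact h.mono (Set.image_mono (Finset.coe_subset.2 hT'))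

/-- An IIA map is a simplicial map of `M₁(A)`. -/
theorem IIA.isSimplicial {A : CentralArrangement V} {f : A.Chamber → A.Chamber}
    (hf : A.IIA f) : IsSimplicial A.M A.M f := by
  rintro T ⟨hT, H, hH⟩
  classical
  refine ⟨T.image f, ⟨hT.image f, H, fun hsep => hH ?_⟩, Finset.coe_image⟩
  obtain ⟨φ, hφ⟩ := hf H
  rw [Finset.coe_image] at hsep
  obtain ⟨_, ⟨_, ⟨c, hc, rfl⟩, rfl⟩, _, ⟨_, ⟨d, hd, rfl⟩, rfl⟩, hxy⟩ := hsep
  refine ⟨_, ⟨c, hc, rfl⟩, _, ⟨d, hd, rfl⟩, fun h => hxy ?_⟩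
  rw [hφ c, hφ d, h]

variable [IsTopologicalAddGroup V] [ContinuousSMul ℝ V]

/-- The continuous self-map of `|M₁(A)|` induced by an IIA map. -/
def IIA.induced {A : CentralArrangement V} {f : A.Chamber → A.Chamber} (hf : A.IIA f) :
    C(Realization A.M, Realization A.M) :=
  hf.isSimplicial.realize

end CentralArrangement

/-! ### Degree -/

/-- Singular homology `H_n(X; ℤ)`. -/
abbrev singularHomology (n : ℕ) (X : Type u) [TopologicalSpace X] : ModuleCat.{u} ℤ :=
  ((AlgebraicTopology.singularHomologyFunctor (ModuleCat.{u} ℤ) n).obj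
    (ModuleCat.of ℤ (ULift.{u} ℤ))).obj (TopCat.of X)

/-- The map that a continuous map induces on singular homology. -/
def singularHomologyMap (n : ℕ) {X Y : Type u} [TopologicalSpace X] [TopologicalSpace Y]
    (g : C(X, Y)) : singularHomology n X →ₗ[ℤ] singularHomology n Y :=
  (((AlgebraicTopology.singularHomologyFunctor (ModuleCat.{u} ℤ) n).obj
    (ModuleCat.of ℤ (ULift.{u} ℤ))).map (TopCat.ofHom g)).hom

/-- Reduced singular homology: the kernel of `H_n(X; ℤ) → H_n(point; ℤ)`. -/
def reducedHomology (n : ℕ) (X : Type u) [TopologicalSpace X] :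
    Submodule ℤ (singularHomology n X) :=
  LinearMap.ker (singularHomologyMap n (ContinuousMap.const X PUnit.unit.{u + 1}))

/-- `HasDegree r g d`: the self-map `g` of a space `X` with the homology of the sphere `S^(r-1)` in
degree `r - 1` has degree `d`, i.e. `H̃_{r-1}(X; ℤ)` is infinite cyclic and `g` acts on it as
multiplication by `d`. For `r = 0` the sphere `S^(-1)` is empty, and its only self-map has
degree `1`. -/
def HasDegree {X : Type u} [TopologicalSpace X] : ℕ → C(X, X) → ℤ → Prop
  | 0, _, d => IsEmpty X ∧ d = 1
  | n + 1, g, d => Nonempty (reducedHomology n X ≃ₗ[ℤ] ℤ) ∧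
      ∀ x ∈ reducedHomology n X, singularHomologyMap n g x = d • x

end

/-!
# Self-maps of `M₁(A)` induced by maps of chambers that satisfy IIA

A map `φ` of the two-element set `Ch({H})` is the identity, the exchange, or constant. If `f` is
surjective, or if the induced map is not null-homotopic, then no `φ H` is constant: otherwise the
image of `f` lies on one side of `H`, which is a face of `M₁(A)`. Conversely, if every `φ H` is an
involution, then `f` is a bijection whose inverse satisfies IIA with the same `φ`, so it induces a
homeomorphism. A map with a fixed chamber fixes a point of every `Ch({H})`, so an injective one has
`φ H = id` for all `H`, and a chamber is determined by its sides.

What ties the degree to this is the computation `H̃_{r-1}(|M₁(A)|; ℤ) ≅ ℤ`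
(`CentralArrangement.nonempty_reducedHomology_realization_equiv`): an automorphism of `ℤ` is `±1`,
and a null-homotopic map acts as zero. The computation has two parts.

* `|M₁(A)|` is homotopy equivalent to `V ∖ L`, where `L` is the intersection of the hyperplanes
  (`CentralArrangement.nonempty_homotopyEquiv_centerCompl`). One map sends barycentric coordinates
  to the corresponding combination of points of the chambers; the other sends `v` to a weighted sum
  of the chambers near `v`. Both composites are joined to the identity by straight lines.
* `H̃_{r-1}(V ∖ L) ≅ ℤ` if `L` has codimension `r`
  (`SingularChain.nonempty_augHomology_compl_equiv`), by induction on `r`. If `L = L' ∩ ker α` with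
  `α ≠ 0` on `L'`, then `V ∖ L` is the union of two star-shaped open sets whose intersection is
  `V ∖ L'`, and the Mayer-Vietoris isomorphism
  (`SingularChain.nonempty_augHomology_union_equiv`) lowers the degree by one.

The Mayer-Vietoris isomorphism rests on the theorem on small chains
(`SingularChain.exists_sub_d_mem_smallChains`), which is proved by barycentric subdivision.
Subdivision and its chain homotopy to the identity are first defined on tuples of points, where
they are given by cones, and then carried to singular chains along singular simplices. All chain
groups are indexed by the number `k` of vertices of a simplex, and `k = 0` is allowed: this gives
the augmented complexes, whose homology is reduced homology, without a special case.
-/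

noncomputable section

open Finsupp

/-! ### Chains of tuples and their subdivision -/

/-- Formal integral combinations of `k`-tuples of points of `Y`. A `k`-tuple is an ordered simplex
with `k` vertices; the empty tuple spans the augmentation term `k = 0`. -/
abbrev TupleChain (Y : Type*) (k : ℕ) := (Fin k → Y) →₀ ℤ

namespace TupleChain

variable {Y Y' : Type*} {k : ℕ}

/-- The boundary: the alternating sum of the tuples with one entry deleted. -/
def d : TupleChain Y (k + 1) →ₗ[ℤ] TupleChain Y k :=
  linearCombination ℤ fun v => ∑ i : Fin (k + 1), (-1 : ℤ) ^ (i : ℕ) • single (v ∘ i.succAbove) 1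

theorem d_single (v : Fin (k + 1) → Y) :
    d (single v 1) = ∑ i : Fin (k + 1), (-1 : ℤ) ^ (i : ℕ) • single (v ∘ i.succAbove) 1 := by
  simp [d]

/-- The cone with apex `b`: `b` is prepended to every tuple. -/
def cone (b : Y) : TupleChain Y k →ₗ[ℤ] TupleChain Y (k + 1) :=
  lmapDomain ℤ ℤ fun v => Fin.cons b v

@[simp]
theorem cone_single (b : Y) (v : Fin k → Y) (m : ℤ) :
    cone b (single v m) = single (Fin.cons b v : Fin (k + 1) → Y) m := by
  simp [cone]

/-- The chain map induced by a map of points. -/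
def map (g : Y → Y') : TupleChain Y k →ₗ[ℤ] TupleChain Y' k :=
  lmapDomain ℤ ℤ fun v => g ∘ v

@[simp]
theorem map_single (g : Y → Y') (v : Fin k → Y) (m : ℤ) :
    map g (single v m) = single (g ∘ v) m := by
  simp [map]

theorem hom_ext {M : Type*} [AddCommGroup M] {F G : TupleChain Y k →ₗ[ℤ] M}
    (h : ∀ v, F (single v 1) = G (single v 1)) : F = G :=
  Finsupp.lhom_ext' fun v => LinearMap.ext_ring (h v)

theorem d_cone_zero (b : Y) (c : TupleChain Y 0) : d (cone b c) = c := by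
  suffices h : d ∘ₗ cone b = LinearMap.id (R := ℤ) (M := TupleChain Y 0) from
    LinearMap.congr_fun h c
  refine hom_ext fun v => ?_
  simp [d_single]

/-- The cone is a contraction of the augmented complex of tuples. -/
theorem d_cone (b : Y) (c : TupleChain Y (k + 1)) : d (cone b c) = c - cone b (d c) := by
  suffices h : d ∘ₗ cone b = LinearMap.id (R := ℤ) (M := TupleChain Y (k + 1)) - cone b ∘ₗ d from
    LinearMap.congr_fun h c
  refine hom_ext fun v => ?_
  simp only [LinearMap.comp_apply, cone_single, d_single, LinearMap.sub_apply, LinearMap.id_apply]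
  rw [Fin.sum_univ_succ]
  simp [pow_succ, sub_eq_add_neg]
  rfl

theorem d_d (c : TupleChain Y (k + 2)) : d (d c) = 0 := by
  suffices h : d ∘ₗ d = (0 : TupleChain Y (k + 2) →ₗ[ℤ] TupleChain Y k) from
    LinearMap.congr_fun h c
  clear c
  refine hom_ext fun v => ?_
  induction k with
  | zero =>
    rw [← Fin.cons_self_tail v, ← cone_single]
    simp only [LinearMap.comp_apply, d_cone, map_sub, d_cone_zero, sub_self, LinearMap.zero_apply]
  | succ k ih =>
    have h : d (d (single (Fin.tail v) 1)) = 0 := ih (Fin.tail v)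
    rw [← Fin.cons_self_tail v, ← cone_single]
    simp only [LinearMap.comp_apply, d_cone, map_sub, h, map_zero, sub_zero, sub_self,
      LinearMap.zero_apply]

theorem map_d (g : Y → Y') (c : TupleChain Y (k + 1)) : map g (d c) = d (map g c) := by
  suffices h : map g ∘ₗ d = d ∘ₗ map (k := k + 1) g from LinearMap.congr_fun h c
  refine hom_ext fun v => ?_
  simp [d_single, Function.comp_assoc]

theorem map_cone (g : Y → Y') (b : Y) (c : TupleChain Y k) :
    map g (cone b c) = cone (g b) (map g c) := by
  suffices h : map g ∘ₗ cone b = cone (g b) ∘ₗ map (k := k) g from LinearMap.congr_fun h c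
  refine hom_ext fun v => ?_
  simp only [LinearMap.comp_apply, cone_single, map_single]
  congr 1
  ext j
  refine Fin.cases ?_ (fun j => ?_) j <;> simp

section Subdivision

variable (β : ∀ k, (Fin (k + 1) → Y) → Y) (β' : ∀ k, (Fin (k + 1) → Y') → Y')

/-- Barycentric subdivision of tuples, where `β` chooses the center of a tuple: the cone from the
center over the subdivided boundary. The empty tuple is not changed. -/
def sd : ∀ k, TupleChain Y k →ₗ[ℤ] TupleChain Y k
  | 0 => LinearMap.id
  | k + 1 => linearCombination ℤ fun v => cone (β k v) (sd k (d (single v 1)))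

/-- The chain homotopy between the identity and `sd`. -/
def sdHomotopy : ∀ k, TupleChain Y k →ₗ[ℤ] TupleChain Y (k + 1)
  | 0 => 0
  | k + 1 => linearCombination ℤ fun v =>
      cone (β k v) (single v 1 - sdHomotopy k (d (single v 1)))

theorem sd_zero (c : TupleChain Y 0) : sd β 0 c = c := rfl

theorem sd_succ_single (v : Fin (k + 1) → Y) :
    sd β (k + 1) (single v 1) = cone (β k v) (sd β k (d (single v 1))) := by
  simp [sd]

theorem sdHomotopy_zero (c : TupleChain Y 0) : sdHomotopy β 0 c = 0 := rfl

theorem sdHomotopy_succ_single (v : Fin (k + 1) → Y) :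
    sdHomotopy β (k + 1) (single v 1) =
      cone (β k v) (single v 1 - sdHomotopy β k (d (single v 1))) := by
  simp [sdHomotopy]

theorem d_sd (c : TupleChain Y (k + 1)) : d (sd β (k + 1) c) = sd β k (d c) := by
  suffices h : d ∘ₗ sd β (k + 1) = sd β k ∘ₗ d from LinearMap.congr_fun h c
  clear c
  refine hom_ext fun v => ?_
  induction k with
  | zero => simp only [LinearMap.comp_apply, sd_succ_single, d_cone_zero]
  | succ k ih =>
    have ih' : d ∘ₗ sd β (k + 1) = sd β k ∘ₗ d := hom_ext ih
    have h := LinearMap.congr_fun ih' (d (single v 1))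
    simp only [LinearMap.comp_apply, d_d, map_zero] at h
    simp only [LinearMap.comp_apply, sd_succ_single, d_cone, h, map_zero, sub_zero]

theorem d_sdHomotopy (c : TupleChain Y (k + 1)) :
    d (sdHomotopy β (k + 1) c) = c - sd β (k + 1) c - sdHomotopy β k (d c) := by
  suffices h : d ∘ₗ sdHomotopy β (k + 1) = LinearMap.id - sd β (k + 1) - sdHomotopy β k ∘ₗ d from
    LinearMap.congr_fun h c
  clear c
  refine hom_ext fun v => ?_
  induction k with
  | zero =>
    simp only [LinearMap.comp_apply, LinearMap.sub_apply, LinearMap.id_apply, sd_succ_single,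
      sdHomotopy_succ_single, d_cone, sdHomotopy_zero, sub_zero, sd_zero]
  | succ k ih =>
    have ih' := hom_ext ih
    have h := LinearMap.congr_fun ih' (d (single v 1))
    simp only [LinearMap.comp_apply, LinearMap.sub_apply, LinearMap.id_apply, d_d, map_zero,
      sub_zero] at h
    simp only [LinearMap.comp_apply, LinearMap.sub_apply, LinearMap.id_apply, sd_succ_single,
      sdHomotopy_succ_single, d_cone, map_sub, h]
    abel

variable {β β'}

theorem map_sd {g : Y → Y'} (hg : ∀ k (v : Fin (k + 1) → Y), g (β k v) = β' k (g ∘ v))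
    (c : TupleChain Y k) : map g (sd β k c) = sd β' k (map g c) := by
  suffices h : map g ∘ₗ sd β k = sd β' k ∘ₗ map g from LinearMap.congr_fun h c
  clear c
  refine hom_ext fun v => ?_
  induction k with
  | zero => rfl
  | succ k ih =>
    have h := LinearMap.congr_fun (hom_ext ih) (d (single v 1))
    simp only [LinearMap.comp_apply] at h
    simp only [LinearMap.comp_apply, sd_succ_single, map_cone, h, hg, map_single, map_d]

theorem map_sdHomotopy {g : Y → Y'} (hg : ∀ k (v : Fin (k + 1) → Y), g (β k v) = β' k (g ∘ v))
    (c : TupleChain Y k) : map g (sdHomotopy β k c) = sdHomotopy β' k (map g c) := by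
  suffices h : map g ∘ₗ sdHomotopy β k = sdHomotopy β' k ∘ₗ map g from LinearMap.congr_fun h c
  clear c
  refine hom_ext fun v => ?_
  induction k with
  | zero => simp [sdHomotopy]
  | succ k ih =>
    have h := LinearMap.congr_fun (hom_ext ih) (d (single v 1))
    simp only [LinearMap.comp_apply] at h
    simp only [LinearMap.comp_apply, sdHomotopy_succ_single, map_cone, h, hg, map_single, map_d,
      map_sub]

end Subdivision

end TupleChain

end

noncomputable section

open Finsupp

/-! ### Singular chains and their subdivision -/

/-- To show that a linear map sends the chains supported in `s` into `N`, it is enough to look at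
the generators. -/
theorem Finsupp.map_mem_of_mem_supported {α M : Type*} [AddCommGroup M] {F : (α →₀ ℤ) →ₗ[ℤ] M}
    {s : Set α} {N : Submodule ℤ M} (h : ∀ a ∈ s, F (single a 1) ∈ N) {c : α →₀ ℤ}
    (hc : c ∈ supported ℤ ℤ s) : F c ∈ N := by
  rw [supported_eq_span_single] at hc
  have : Submodule.span ℤ ((fun i => single i (1 : ℤ)) '' s) ≤ N.comap F := by
    rw [Submodule.span_le]
    rintro _ ⟨a, ha, rfl⟩
    exact h a ha
  exact this hc

/-- The affine map from a standard simplex to the simplex with vertices `v`. -/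
def affineSimplex {n k : ℕ} (v : Fin k → stdSimplex ℝ (Fin n)) :
    C(stdSimplex ℝ (Fin k), stdSimplex ℝ (Fin n)) where
  toFun t := ⟨∑ i, t i • (v i).1,
    (convex_stdSimplex ℝ (Fin n)).sum_mem (fun i _ => t.2.1 i) t.2.2 fun i _ => (v i).2⟩
  continuous_toFun := by
    refine Continuous.subtype_mk (continuous_finsetSum _ fun i _ => ?_) _
    exact ((continuous_apply i).comp continuous_subtype_val).smul continuous_const

theorem affineSimplex_coe {n k : ℕ} (v : Fin k → stdSimplex ℝ (Fin n))
    (t : stdSimplex ℝ (Fin k)) : (affineSimplex v t).1 = ∑ i, t i • (v i).1 := rfl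

theorem affineSimplex_comp_affineSimplex {n k l : ℕ} (v : Fin k → stdSimplex ℝ (Fin n))
    (w : Fin l → stdSimplex ℝ (Fin k)) :
    (affineSimplex v).comp (affineSimplex w) = affineSimplex (affineSimplex v ∘ w) := by
  ext t : 1
  apply Subtype.ext
  simp only [ContinuousMap.comp_apply, affineSimplex_coe, Function.comp_apply, Finset.smul_sum,
    smul_smul]
  rw [Finset.sum_comm]
  refine Finset.sum_congr rfl fun i _ => ?_
  rw [← Finset.sum_smul]
  congr 1
  change (∑ j, t j • (w j).1) i = _
  simp [Finset.sum_apply]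
  rfl

theorem affineSimplex_vertex (n : ℕ) :
    affineSimplex (fun i : Fin n => stdSimplex.vertex (S := ℝ) i) = ContinuousMap.id _ := by
  ext t : 1
  apply Subtype.ext
  ext j
  simp [affineSimplex_coe, Finset.sum_apply, Pi.single_apply]
  rfl

/-- The inclusion of the `i`-th face of a standard simplex. -/
def simplexFace {k : ℕ} (i : Fin (k + 1)) : C(stdSimplex ℝ (Fin k), stdSimplex ℝ (Fin (k + 1))) :=
  ⟨stdSimplex.map i.succAbove, stdSimplex.continuous_map _⟩

theorem affineSimplex_comp_face {n k : ℕ} (v : Fin (k + 1) → stdSimplex ℝ (Fin n))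
    (i : Fin (k + 1)) :
    (affineSimplex v).comp (simplexFace i) = affineSimplex (v ∘ i.succAbove) := by
  ext t : 1
  apply Subtype.ext
  simp only [ContinuousMap.comp_apply, affineSimplex_coe, Function.comp_apply]
  rw [Fin.sum_univ_succAbove _ i]
  have h0 : (simplexFace i t : stdSimplex ℝ (Fin (k + 1))) i = 0 := by
    change FunOnFinite.linearMap ℝ ℝ i.succAbove t i = 0
    rw [FunOnFinite.linearMap_apply_apply]
    refine Finset.sum_eq_zero fun j hj => ?_
    exact absurd (Finset.mem_filter.1 hj).2 (Fin.succAbove_ne i j)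
  have h1 : ∀ j, (simplexFace i t : stdSimplex ℝ (Fin (k + 1))) (i.succAbove j) = t j := by
    intro j
    change FunOnFinite.linearMap ℝ ℝ i.succAbove t (i.succAbove j) = t j
    rw [FunOnFinite.linearMap_apply_apply, Finset.sum_eq_single j]
    · intro b hb hbj
      exact absurd (Fin.succAbove_right_injective (Finset.mem_filter.1 hb).2) hbj
    · intro h
      exact absurd (by simp) h
  simp only [h0, h1, zero_smul, zero_add]

/-- The barycenter of the tuple `v`. -/
def simplexCenter {n : ℕ} (k : ℕ) (v : Fin (k + 1) → stdSimplex ℝ (Fin n)) :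
    stdSimplex ℝ (Fin n) :=
  affineSimplex v stdSimplex.barycenter

theorem affineSimplex_simplexCenter {n l k : ℕ} (u : Fin n → stdSimplex ℝ (Fin l))
    (v : Fin (k + 1) → stdSimplex ℝ (Fin n)) :
    affineSimplex u (simplexCenter k v) = simplexCenter k (affineSimplex u ∘ v) := by
  unfold simplexCenter
  rw [← affineSimplex_comp_affineSimplex]
  rfl

/-- Singular chains with integral coefficients, indexed by the number `k` of vertices. The standard
simplex with no vertices is empty, so there is one singular simplex for `k = 0`, and the complex is
augmented. -/
abbrev SingularChain (X : Type*) [TopologicalSpace X] (k : ℕ) :=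
  C(stdSimplex ℝ (Fin k), X) →₀ ℤ

namespace SingularChain

variable {X : Type*} [TopologicalSpace X] {k n : ℕ}

/-- The boundary: the alternating sum of the faces. For `k = 0` it is the augmentation. -/
def d : SingularChain X (k + 1) →ₗ[ℤ] SingularChain X k :=
  linearCombination ℤ fun σ =>
    ∑ i : Fin (k + 1), (-1 : ℤ) ^ (i : ℕ) • single (σ.comp (simplexFace i)) 1

theorem d_single (σ : C(stdSimplex ℝ (Fin (k + 1)), X)) :
    d (single σ 1) =
      ∑ i : Fin (k + 1), (-1 : ℤ) ^ (i : ℕ) • single (σ.comp (simplexFace i)) 1 := by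
  simp [d]

theorem hom_ext {M : Type*} [AddCommGroup M] {F G : SingularChain X k →ₗ[ℤ] M}
    (h : ∀ σ, F (single σ 1) = G (single σ 1)) : F = G :=
  Finsupp.lhom_ext' fun v => LinearMap.ext_ring (h v)

/-- The chain map that sends a tuple `v` of points of a standard simplex to the singular simplex
`σ ∘ affineSimplex v`. -/
def push (σ : C(stdSimplex ℝ (Fin n), X)) :
    TupleChain (stdSimplex ℝ (Fin n)) k →ₗ[ℤ] SingularChain X k :=
  lmapDomain ℤ ℤ fun v => σ.comp (affineSimplex v)

theorem push_single (σ : C(stdSimplex ℝ (Fin n), X)) (v : Fin k → stdSimplex ℝ (Fin n)) :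
    push σ (single v 1) = single (σ.comp (affineSimplex v)) 1 := by
  simp [push]

theorem push_comp_affineSimplex {l : ℕ} (σ : C(stdSimplex ℝ (Fin n), X))
    (u : Fin l → stdSimplex ℝ (Fin n)) (c : TupleChain (stdSimplex ℝ (Fin l)) k) :
    push (σ.comp (affineSimplex u)) c = push σ (TupleChain.map (affineSimplex u) c) := by
  suffices h : push (σ.comp (affineSimplex u)) = push σ ∘ₗ
    TupleChain.map (k := k) (affineSimplex u) from LinearMap.congr_fun h c
  refine TupleChain.hom_ext fun v => ?_
  simp only [LinearMap.comp_apply, TupleChain.map_single, push_single, ContinuousMap.comp_assoc,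
    affineSimplex_comp_affineSimplex]

theorem push_d (σ : C(stdSimplex ℝ (Fin n), X))
    (c : TupleChain (stdSimplex ℝ (Fin n)) (k + 1)) :
    push σ (TupleChain.d c) = d (push σ c) := by
  suffices h : push σ ∘ₗ TupleChain.d (k := k) = d ∘ₗ push σ from LinearMap.congr_fun h c
  refine TupleChain.hom_ext fun v => ?_
  simp only [LinearMap.comp_apply, TupleChain.d_single, push_single, d_single, map_sum,
    map_zsmul, ContinuousMap.comp_assoc, affineSimplex_comp_face]

/-- The tuple of vertices of a standard simplex, as a chain. It is the universal chain: `push σ`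
sends it to `σ`. -/
def vertices (n : ℕ) : TupleChain (stdSimplex ℝ (Fin n)) n :=
  single (fun i => stdSimplex.vertex i) 1

theorem push_vertices (σ : C(stdSimplex ℝ (Fin n), X)) : push σ (vertices n) = single σ 1 := by
  rw [vertices, push_single, affineSimplex_vertex, ContinuousMap.comp_id]

theorem map_vertices (v : Fin k → stdSimplex ℝ (Fin n)) :
    TupleChain.map (affineSimplex v) (vertices k) = single v 1 := by
  rw [vertices, TupleChain.map_single]
  congr 1
  funext i
  apply Subtype.ext
  ext j
  simp [affineSimplex_coe, Finset.sum_apply, Pi.single_apply, ite_apply]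

theorem d_d (c : SingularChain X (k + 2)) : d (d c) = 0 := by
  suffices h : d ∘ₗ d = (0 : SingularChain X (k + 2) →ₗ[ℤ] SingularChain X k) from
    LinearMap.congr_fun h c
  refine hom_ext fun σ => ?_
  rw [← push_vertices]
  simp only [LinearMap.comp_apply, ← push_d, TupleChain.d_d, map_zero, LinearMap.zero_apply]

/-- Barycentric subdivision of singular chains. -/
def subdivide (k : ℕ) : SingularChain X k →ₗ[ℤ] SingularChain X k :=
  linearCombination ℤ fun σ => push σ (TupleChain.sd simplexCenter k (vertices k))

/-- The chain homotopy between the identity and `subdivide`. -/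
def subdivideHomotopy (k : ℕ) : SingularChain X k →ₗ[ℤ] SingularChain X (k + 1) :=
  linearCombination ℤ fun σ => push σ (TupleChain.sdHomotopy simplexCenter k (vertices k))

theorem subdivide_push (σ : C(stdSimplex ℝ (Fin n), X))
    (c : TupleChain (stdSimplex ℝ (Fin n)) k) :
    subdivide k (push σ c) = push σ (TupleChain.sd simplexCenter k c) := by
  suffices h : subdivide k ∘ₗ push σ = push σ ∘ₗ TupleChain.sd simplexCenter k from
    LinearMap.congr_fun h c
  refine TupleChain.hom_ext fun v => ?_
  simp only [LinearMap.comp_apply, push_single, subdivide, linearCombination_single, one_smul]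
  rw [push_comp_affineSimplex, TupleChain.map_sd (β' := simplexCenter)
    (fun k w => affineSimplex_simplexCenter v w), map_vertices]

theorem subdivideHomotopy_push (σ : C(stdSimplex ℝ (Fin n), X))
    (c : TupleChain (stdSimplex ℝ (Fin n)) k) :
    subdivideHomotopy k (push σ c) = push σ (TupleChain.sdHomotopy simplexCenter k c) := by
  suffices h : subdivideHomotopy k ∘ₗ push σ = push σ ∘ₗ TupleChain.sdHomotopy simplexCenter k from
    LinearMap.congr_fun h c
  refine TupleChain.hom_ext fun v => ?_
  simp only [LinearMap.comp_apply, push_single, subdivideHomotopy, linearCombination_single,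
    one_smul]
  rw [push_comp_affineSimplex, TupleChain.map_sdHomotopy (β' := simplexCenter)
    (fun k w => affineSimplex_simplexCenter v w), map_vertices]

theorem d_subdivide (c : SingularChain X (k + 1)) :
    d (subdivide (k + 1) c) = subdivide k (d c) := by
  suffices h : d ∘ₗ subdivide (X := X) (k + 1) = subdivide k ∘ₗ d from LinearMap.congr_fun h c
  refine hom_ext fun σ => ?_
  rw [← push_vertices]
  simp only [LinearMap.comp_apply, subdivide_push, ← push_d, TupleChain.d_sd]

theorem d_subdivideHomotopy (c : SingularChain X (k + 1)) :
    d (subdivideHomotopy (k + 1) c) = c - subdivide (k + 1) c - subdivideHomotopy k (d c) := by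
  suffices h : d ∘ₗ subdivideHomotopy (X := X) (k + 1) =
    LinearMap.id - subdivide (k + 1) - subdivideHomotopy k ∘ₗ d from LinearMap.congr_fun h c
  refine hom_ext fun σ => ?_
  rw [← push_vertices]
  simp only [LinearMap.comp_apply, LinearMap.sub_apply, LinearMap.id_apply, subdivide_push,
    subdivideHomotopy_push, ← push_d, TupleChain.d_sdHomotopy, map_sub]

/-! ### Chains in a subset -/

/-- The chains whose simplices have image in `S`. -/
def chainsIn (S : Set X) (k : ℕ) : Submodule ℤ (SingularChain X k) :=
  supported ℤ ℤ {σ | Set.range σ ⊆ S}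

variable {S : Set X}

theorem single_mem_chainsIn {σ : C(stdSimplex ℝ (Fin k), X)} (h : Set.range σ ⊆ S) :
    single σ 1 ∈ chainsIn S k :=
  single_mem_supported ℤ _ h

theorem chainsIn_mono {S' : Set X} (h : S ⊆ S') : chainsIn S k ≤ chainsIn S' k :=
  supported_mono fun _ hσ => hσ.trans h

theorem chainsIn_inter (S S' : Set X) : chainsIn (S ∩ S') k = chainsIn S k ⊓ chainsIn S' k := by
  rw [chainsIn, chainsIn, chainsIn, ← supported_inter]
  congr 1
  ext σ
  exact Set.subset_inter_iff

theorem push_mem_chainsIn {σ : C(stdSimplex ℝ (Fin n), X)} (h : Set.range σ ⊆ S)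
    (c : TupleChain (stdSimplex ℝ (Fin n)) k) : push σ c ∈ chainsIn S k := by
  refine map_mem_of_mem_supported (s := Set.univ) (fun v _ => ?_) (by simp)
  rw [push_single]
  refine single_mem_chainsIn ?_
  rintro _ ⟨t, rfl⟩
  exact h ⟨_, rfl⟩

theorem d_mem_chainsIn {c : SingularChain X (k + 1)} (hc : c ∈ chainsIn S (k + 1)) :
    d c ∈ chainsIn S k := by
  refine map_mem_of_mem_supported (fun σ hσ => ?_) hc
  rw [← push_vertices, ← push_d]
  exact push_mem_chainsIn hσ _

theorem subdivide_mem_chainsIn {c : SingularChain X k} (hc : c ∈ chainsIn S k) :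
    subdivide k c ∈ chainsIn S k := by
  refine map_mem_of_mem_supported (fun σ hσ => ?_) hc
  rw [← push_vertices, subdivide_push]
  exact push_mem_chainsIn hσ _

theorem subdivideHomotopy_mem_chainsIn {c : SingularChain X k} (hc : c ∈ chainsIn S k) :
    subdivideHomotopy k c ∈ chainsIn S (k + 1) := by
  refine map_mem_of_mem_supported (fun σ hσ => ?_) hc
  rw [← push_vertices, subdivideHomotopy_push]
  exact push_mem_chainsIn hσ _

end SingularChain

end

noncomputable section

open Finsupp

/-! ### Barycentric subdivision makes simplices small -/

/-- The distance from the barycenter of `k + 1` points to a point of their convex hull is at most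
`k / (k + 1)` times a bound for their mutual distances. -/
theorem dist_simplexCenter_le {n k : ℕ} {v : Fin (k + 1) → stdSimplex ℝ (Fin n)} {D : ℝ}
    (hD : ∀ i j, dist (v i) (v j) ≤ D) {x : stdSimplex ℝ (Fin n)}
    (hx : x.1 ∈ convexHull ℝ (Set.range fun i => (v i).1)) :
    dist (simplexCenter k v) x ≤ (1 - 1 / ((k : ℝ) + 1)) * D := by
  have hc : (simplexCenter k v).1 = ∑ i, ((k : ℝ) + 1)⁻¹ • (v i).1 := by
    rw [simplexCenter, affineSimplex_coe]
    refine Finset.sum_congr rfl fun i _ => ?_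
    congr 1
    change (stdSimplex.barycenter : stdSimplex ℝ (Fin (k + 1))).1 i = _
    simp
  have hk : (0 : ℝ) < (k : ℝ) + 1 := by positivity
  suffices h : convexHull ℝ (Set.range fun i => (v i).1) ⊆
      Metric.closedBall (simplexCenter k v).1 ((1 - 1 / ((k : ℝ) + 1)) * D) by
    have := h hx
    rw [Metric.mem_closedBall, dist_comm] at this
    exact this
  -- A ball is convex, so it is enough to bound the distances to the vertices.
  refine convexHull_min ?_ (convex_closedBall _ _)
  rintro _ ⟨i, rfl⟩
  rw [Metric.mem_closedBall, dist_comm, dist_eq_norm]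
  have h1 : (simplexCenter k v).1 - (v i).1 =
      ∑ j ∈ Finset.univ.erase i, ((k : ℝ) + 1)⁻¹ • ((v j).1 - (v i).1) := by
    rw [Finset.sum_erase _ (by simp), hc]
    simp only [smul_sub, Finset.sum_sub_distrib]
    congr 1
    rw [Finset.sum_const, Finset.card_univ, Fintype.card_fin, ← Nat.cast_smul_eq_nsmul ℝ, smul_smul]
    rw [Nat.cast_succ, mul_inv_cancel₀ hk.ne', one_smul]
  -- The `i`-th of the `k + 1` summands vanishes; this is where the gain comes from.
  rw [h1]
  refine (norm_sum_le_of_le _ (f := fun j => ((k : ℝ) + 1)⁻¹ • ((v j).1 - (v i).1))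
    (n := fun _ => ((k : ℝ) + 1)⁻¹ * D) fun j _ => ?_).trans ?_
  · rw [norm_smul, Real.norm_of_nonneg (by positivity)]
    have := hD j i
    rw [Subtype.dist_eq, dist_eq_norm] at this
    gcongr
  · rw [Finset.sum_const, Finset.card_erase_of_mem (Finset.mem_univ i), Finset.card_univ,
      Fintype.card_fin, nsmul_eq_mul]
    refine le_of_eq ?_
    simp only [Nat.add_sub_cancel]
    field_simp
    ring

namespace TupleChain

variable {n k : ℕ}

/-- The tuples whose entries have mutual distances at most `D`. -/
def smallTuples (n k : ℕ) (D : ℝ) : Set (Fin k → stdSimplex ℝ (Fin n)) :=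
  {w | ∀ i j, dist (w i) (w j) ≤ D}

/-- The tuples of `smallTuples n k D` whose entries lie in the convex hull of `K`. -/
def smallTuplesIn (n k : ℕ) (D : ℝ) (K : Set (Fin n → ℝ)) : Set (Fin k → stdSimplex ℝ (Fin n)) :=
  {w | w ∈ smallTuples n k D ∧ ∀ i, (w i).1 ∈ convexHull ℝ K}

/-- Subdivision of a tuple with at most `N` entries shrinks mutual distances by the factor
`1 - 1 / N`. The convex hull is carried along for the induction: it bounds the distance of the new
center to the later vertices. -/
theorem sd_single_mem {N : ℕ} {D : ℝ} (hD0 : 0 ≤ D) (hk : k ≤ N) {v : Fin k → stdSimplex ℝ (Fin n)}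
    (hD : v ∈ smallTuples n k D) :
    sd simplexCenter k (single v 1) ∈
      supported ℤ ℤ (smallTuplesIn n k ((1 - 1 / (N : ℝ)) * D) (Set.range fun i => (v i).1)) := by
  induction k with
  | zero => exact single_mem_supported ℤ _ ⟨fun i => i.elim0, fun i => i.elim0⟩
  | succ k ih =>
    have hN : (0 : ℝ) < N := by
      have : 0 < N := by omega
      exact_mod_cast this
    have hkN : ((k : ℝ) + 1) ≤ N := by exact_mod_cast hk
    have hq : 0 ≤ 1 - 1 / (N : ℝ) := by
      have hN1 : (1 : ℝ) ≤ N := le_trans (by linarith [Nat.cast_nonneg (α := ℝ) k]) hkN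
      rw [sub_nonneg, div_le_one hN]
      exact hN1
    rw [sd_succ_single]
    refine map_mem_of_mem_supported (F := cone (simplexCenter k v))
      (s := smallTuplesIn n k ((1 - 1 / (N : ℝ)) * D) (Set.range fun i => (v i).1))
      (fun w hw => ?_) ?_
    · rw [cone_single]
      have hdist : ∀ x : stdSimplex ℝ (Fin n), x.1 ∈ convexHull ℝ (Set.range fun i => (v i).1) →
          dist (simplexCenter k v) x ≤ (1 - 1 / (N : ℝ)) * D := by
        intro x hx
        refine (dist_simplexCenter_le hD hx).trans ?_
        gcongr
      refine single_mem_supported ℤ _ ⟨?_, ?_⟩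
      · intro i j
        refine Fin.cases ?_ (fun i => ?_) i <;> refine Fin.cases ?_ (fun j => ?_) j
        · simpa using mul_nonneg hq hD0
        · exact hdist _ (hw.2 j)
        · rw [dist_comm]
          exact hdist _ (hw.2 i)
        · exact hw.1 i j
      · intro i
        refine Fin.cases ?_ (fun i => ?_) i
        · change (affineSimplex v stdSimplex.barycenter).1 ∈ _
          rw [affineSimplex_coe]
          exact (convex_convexHull ℝ _).sum_mem
            (fun i _ => stdSimplex.barycenter.2.1 i) stdSimplex.barycenter.2.2
            fun i _ => subset_convexHull ℝ _ ⟨i, rfl⟩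
        · exact hw.2 i
    · rw [d_single, map_sum]
      refine Submodule.sum_mem _ fun i _ => ?_
      rw [map_zsmul]
      refine Submodule.smul_mem _ _ ?_
      refine supported_mono ?_ (ih (by omega) (v := v ∘ i.succAbove) fun _ _ => hD _ _)
      rintro w ⟨hw, hw'⟩
      refine ⟨hw, fun j => convexHull_mono ?_ (hw' j)⟩
      rintro _ ⟨l, rfl⟩
      exact ⟨_, rfl⟩

theorem sd_pow_vertices_mem (n m : ℕ) :
    (sd simplexCenter n ^ m) (SingularChain.vertices n) ∈
      supported ℤ ℤ (smallTuples n n ((1 - 1 / (n : ℝ)) ^ m)) := by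
  have hq : 0 ≤ 1 - 1 / (n : ℝ) := by
    rcases Nat.eq_zero_or_pos n with rfl | hn
    · simp
    · have hn1 : (1 : ℝ) ≤ n := by exact_mod_cast hn
      rw [sub_nonneg, div_le_one (by linarith)]
      exact hn1
  induction m with
  | zero =>
    refine single_mem_supported ℤ _ fun i j => ?_
    rw [pow_zero]
    exact (Metric.dist_le_diam_of_mem (bounded_stdSimplex _) (Subtype.prop _)
      (Subtype.prop _)).trans diam_stdSimplex_le
  | succ m ih =>
    rw [pow_succ', pow_succ', Module.End.mul_apply]
    refine map_mem_of_mem_supported (fun v hv => ?_) ih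
    refine supported_mono ?_ (sd_single_mem (pow_nonneg hq m) le_rfl hv)
    exact fun w hw => hw.1

end TupleChain

namespace SingularChain

variable {X : Type*} [TopologicalSpace X] {k n : ℕ} {U W : Set X}

theorem subdivide_pow_push (σ : C(stdSimplex ℝ (Fin n), X)) (m : ℕ)
    (c : TupleChain (stdSimplex ℝ (Fin n)) k) :
    (subdivide k ^ m) (push σ c) = push σ ((TupleChain.sd simplexCenter k ^ m) c) := by
  induction m with
  | zero => rfl
  | succ m ih => simp only [pow_succ', Module.End.mul_apply, ih, subdivide_push]

/-- The sums of a chain in `U` and a chain in `W`. -/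
def smallChains (U W : Set X) (k : ℕ) : Submodule ℤ (SingularChain X k) :=
  chainsIn U k ⊔ chainsIn W k

theorem subdivide_pow_mem_smallChains {c : SingularChain X k} (m : ℕ)
    (hc : c ∈ smallChains U W k) : (subdivide k ^ m) c ∈ smallChains U W k := by
  induction m with
  | zero => exact hc
  | succ m ih =>
    rw [pow_succ', Module.End.mul_apply]
    obtain ⟨a, ha, b, hb, hab⟩ := Submodule.mem_sup.1 ih
    rw [← hab, map_add]
    exact Submodule.add_mem_sup (subdivide_mem_chainsIn ha) (subdivide_mem_chainsIn hb)

theorem subdivideHomotopy_mem_smallChains {c : SingularChain X k}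
    (hc : c ∈ smallChains U W k) : subdivideHomotopy k c ∈ smallChains U W (k + 1) := by
  obtain ⟨a, ha, b, hb, hab⟩ := Submodule.mem_sup.1 hc
  rw [← hab, map_add]
  exact Submodule.add_mem_sup (subdivideHomotopy_mem_chainsIn ha)
    (subdivideHomotopy_mem_chainsIn hb)

/-- A singular simplex in `U ∪ W` becomes small after enough subdivisions, by Lebesgue's number
lemma. -/
theorem exists_subdivide_pow_single_mem (hU : IsOpen U) (hW : IsOpen W)
    {σ : C(stdSimplex ℝ (Fin k), X)} (hσ : Set.range σ ⊆ U ∪ W) :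
    ∃ m : ℕ, (subdivide k ^ m) (single σ 1) ∈ smallChains U W k := by
  obtain ⟨δ, hδ, hball⟩ := lebesgue_number_lemma_of_metric (s := Set.univ) (isCompact_univ)
    (c := fun b : Bool => σ ⁻¹' (cond b U W))
    (fun b => by cases b; exacts [hW.preimage σ.continuous, hU.preimage σ.continuous])
    (fun x _ => by
      rcases hσ ⟨x, rfl⟩ with h | h
      · exact Set.mem_iUnion.2 ⟨true, h⟩
      · exact Set.mem_iUnion.2 ⟨false, h⟩)
  rcases Nat.eq_zero_or_pos k with rfl | hk
  · refine ⟨0, Submodule.mem_sup_left (single_mem_chainsIn ?_)⟩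
    rintro _ ⟨x, rfl⟩
    have := stdSimplex.sum_eq_one x
    simp at this
  have hk0 : (0 : ℝ) < k := by exact_mod_cast hk
  have hq1 : 1 - 1 / (k : ℝ) < 1 := by
    have : 0 < 1 / (k : ℝ) := by positivity
    linarith
  have hq0 : 0 ≤ 1 - 1 / (k : ℝ) := by
    have hn1 : (1 : ℝ) ≤ k := by exact_mod_cast hk
    rw [sub_nonneg, div_le_one hk0]
    exact hn1
  obtain ⟨m, hm⟩ := exists_pow_lt_of_lt_one hδ hq1
  refine ⟨m, ?_⟩
  rw [← push_vertices, subdivide_pow_push]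
  refine map_mem_of_mem_supported (fun v hv => ?_) (TupleChain.sd_pow_vertices_mem k m)
  rw [push_single]
  obtain ⟨b, hb⟩ := hball (v ⟨0, hk⟩) (Set.mem_univ _)
  have hr : Set.range (σ.comp (affineSimplex v)) ⊆ cond b U W := by
    rintro _ ⟨t, rfl⟩
    have ht : ∑ i, t i • (v i).1 ∈ Metric.ball (v ⟨0, hk⟩).1 δ :=
      (convex_ball _ _).sum_mem (fun i _ => t.2.1 i) t.2.2
        fun i _ => lt_of_le_of_lt (hv i ⟨0, hk⟩) hm
    have ht' : affineSimplex v t ∈ Metric.ball (v ⟨0, hk⟩) δ := ht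
    have := hb ht'
    cases b <;> exact this
  cases b
  · exact Submodule.mem_sup_right (single_mem_chainsIn hr)
  · exact Submodule.mem_sup_left (single_mem_chainsIn hr)

theorem exists_subdivide_pow_mem (hU : IsOpen U) (hW : IsOpen W) {c : SingularChain X k}
    (hc : c ∈ chainsIn (U ∪ W) k) : ∃ m : ℕ, (subdivide k ^ m) c ∈ smallChains U W k := by
  rw [chainsIn, supported_eq_span_single] at hc
  induction hc using Submodule.span_induction with
  | mem x hx =>
    obtain ⟨σ, hσ, rfl⟩ := hx
    exact exists_subdivide_pow_single_mem hU hW hσ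
  | zero => exact ⟨0, Submodule.zero_mem _⟩
  | add x y _ _ hx hy =>
    obtain ⟨m, hm⟩ := hx
    obtain ⟨l, hl⟩ := hy
    refine ⟨m + l, ?_⟩
    rw [map_add]
    refine Submodule.add_mem _ ?_ ?_
    · rw [add_comm, pow_add]
      exact subdivide_pow_mem_smallChains l hm
    · rw [pow_add]
      exact subdivide_pow_mem_smallChains m hl
  | smul a x _ hx =>
    obtain ⟨m, hm⟩ := hx
    exact ⟨m, by rw [map_smul]; exact Submodule.smul_mem _ _ hm⟩

/-- The theorem on small chains: a chain in `U ∪ W` with small boundary is small up to a boundary. -/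
theorem exists_sub_d_mem_smallChains (hU : IsOpen U) (hW : IsOpen W) {c : SingularChain X (k + 1)}
    (hc : c ∈ chainsIn (U ∪ W) (k + 1)) (hd : d c ∈ smallChains U W k) :
    ∃ e ∈ chainsIn (U ∪ W) (k + 2), c - d e ∈ smallChains U W (k + 1) := by
  obtain ⟨m, hm⟩ := exists_subdivide_pow_mem hU hW hc
  suffices h : ∀ m : ℕ, ∃ e ∈ chainsIn (U ∪ W) (k + 2),
      c - (subdivide (k + 1) ^ m) c - d e ∈ smallChains U W (k + 1) by
    obtain ⟨e, he, hme⟩ := h m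
    refine ⟨e, he, ?_⟩
    convert Submodule.add_mem _ hme hm using 1
    abel
  clear hm m
  have hcm : ∀ m : ℕ, (subdivide (k + 1) ^ m) c ∈ chainsIn (U ∪ W) (k + 1) ∧
      d ((subdivide (k + 1) ^ m) c) = (subdivide k ^ m) (d c) := by
    intro m
    induction m with
    | zero => exact ⟨hc, rfl⟩
    | succ m ih =>
      simp only [pow_succ', Module.End.mul_apply]
      exact ⟨subdivide_mem_chainsIn ih.1, by rw [d_subdivide, ih.2]⟩
  intro m
  induction m with
  | zero =>
    refine ⟨0, Submodule.zero_mem _, ?_⟩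
    simp
  | succ m ih =>
    obtain ⟨e, he, hme⟩ := ih
    refine ⟨e + subdivideHomotopy (k + 1) ((subdivide (k + 1) ^ m) c),
      Submodule.add_mem _ he (subdivideHomotopy_mem_chainsIn (hcm m).1), ?_⟩
    have h2 := subdivideHomotopy_mem_smallChains (subdivide_pow_mem_smallChains m hd)
    convert Submodule.add_mem _ hme h2 using 1
    rw [map_add, d_subdivideHomotopy, (hcm m).2, pow_succ', Module.End.mul_apply]
    abel

end SingularChain

end

noncomputable section

open Finsupp

/-! ### Augmented homology of a subset and the Mayer-Vietoris isomorphism -/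

theorem nonempty_addEquiv_of_ker_eq {M N P : Type*} [AddCommGroup M] [AddCommGroup N]
    [AddCommGroup P] {F : P →+ M} {G : P →+ N} (hF : Function.Surjective F)
    (hG : Function.Surjective G) (h : ∀ x, F x = 0 ↔ G x = 0) : Nonempty (M ≃+ N) :=
  have hker : F.ker = G.ker := by
    ext x
    exact h x
  ⟨(QuotientAddGroup.quotientKerEquivOfSurjective F hF).symm.trans
    ((QuotientAddGroup.quotientAddEquivOfEq hker).trans
      (QuotientAddGroup.quotientKerEquivOfSurjective G hG))⟩

namespace SingularChain

variable {X : Type*} [TopologicalSpace X]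

/-- The cycles of the augmented complex. -/
def allCycles (X : Type*) [TopologicalSpace X] : ∀ k, Submodule ℤ (SingularChain X k)
  | 0 => ⊤
  | _ + 1 => LinearMap.ker d

theorem d_mem_allCycles {k : ℕ} (c : SingularChain X (k + 1)) : d c ∈ allCycles X k := by
  cases k with
  | zero => trivial
  | succ k => exact d_d c

/-- The cycles in `S`. -/
def cyclesIn (S : Set X) (k : ℕ) : Submodule ℤ (SingularChain X k) :=
  chainsIn S k ⊓ allCycles X k

/-- The boundaries of the chains in `S`. -/
def boundariesIn (S : Set X) (k : ℕ) : Submodule ℤ (SingularChain X k) :=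
  (chainsIn S (k + 1)).map d

/-- The homology of the augmented complex of singular chains in `S`, at the chains with `k` vertices;
it is the reduced homology of `S` in degree `k - 1`. -/
abbrev AugHomology (S : Set X) (k : ℕ) : Type _ :=
  cyclesIn S k ⧸ (boundariesIn S k).submoduleOf (cyclesIn S k)

/-- The augmented complex of singular chains in `S` is exact. -/
def IsAcyclic (S : Set X) : Prop := ∀ k, cyclesIn S k ≤ boundariesIn S k

/-- The Mayer-Vietoris isomorphism for two acyclic open sets. Both sides are quotients of the group
of pairs `(a, b)` of a chain in `U` and a chain in `W` with `d a = d b`, by `(a, b) ↦ a - b` and by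
`(a, b) ↦ d a`, and these two maps have the same kernel. -/
theorem nonempty_augHomology_union_equiv {U W : Set X} (hU : IsOpen U) (hW : IsOpen W)
    (hUa : IsAcyclic U) (hWa : IsAcyclic W) (k : ℕ) :
    Nonempty (AugHomology (U ∪ W) (k + 1) ≃+ AugHomology (U ∩ W) k) := by
  let P : Submodule ℤ (SingularChain X (k + 1) × SingularChain X (k + 1)) :=
    ((chainsIn U (k + 1)).prod (chainsIn W (k + 1))) ⊓
      LinearMap.ker (d ∘ₗ LinearMap.fst ℤ _ _ - d ∘ₗ LinearMap.snd ℤ _ _)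
  have hP : ∀ x : P, x.1.1 ∈ chainsIn U (k + 1) ∧ x.1.2 ∈ chainsIn W (k + 1) ∧
      d x.1.1 = d x.1.2 := fun x => ⟨x.2.1.1, x.2.1.2, sub_eq_zero.1 x.2.2⟩
  let F : P →ₗ[ℤ] AugHomology (U ∪ W) (k + 1) :=
    Submodule.mkQ _ ∘ₗ LinearMap.codRestrict (cyclesIn (U ∪ W) (k + 1))
      ((LinearMap.fst ℤ _ _ - LinearMap.snd ℤ _ _) ∘ₗ P.subtype) fun x => by
        obtain ⟨h1, h2, h3⟩ := hP x
        refine ⟨Submodule.sub_mem _ (chainsIn_mono Set.subset_union_left h1)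
          (chainsIn_mono Set.subset_union_right h2), ?_⟩
        change d (x.1.1 - x.1.2) = 0
        rw [map_sub, h3, sub_self]
  let G : P →ₗ[ℤ] AugHomology (U ∩ W) k :=
    Submodule.mkQ _ ∘ₗ LinearMap.codRestrict (cyclesIn (U ∩ W) k)
      ((d ∘ₗ LinearMap.fst ℤ _ _) ∘ₗ P.subtype) fun x => by
        obtain ⟨h1, h2, h3⟩ := hP x
        refine ⟨?_, d_mem_allCycles _⟩
        rw [chainsIn_inter]
        refine ⟨d_mem_chainsIn h1, ?_⟩
        change d x.1.1 ∈ _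
        rw [h3]
        exact d_mem_chainsIn h2
  have hFker : ∀ x : P, F x = 0 ↔ x.1.1 - x.1.2 ∈ boundariesIn (U ∪ W) (k + 1) := fun x =>
    Submodule.Quotient.mk_eq_zero _
  have hGker : ∀ x : P, G x = 0 ↔ d x.1.1 ∈ boundariesIn (U ∩ W) k := fun x =>
    Submodule.Quotient.mk_eq_zero _
  refine nonempty_addEquiv_of_ker_eq (F := F.toAddMonoidHom) (G := G.toAddMonoidHom) ?_ ?_ ?_
  · intro y
    obtain ⟨⟨z, hz, hdz⟩, rfl⟩ := Submodule.mkQ_surjective _ y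
    replace hdz : d z = 0 := hdz
    obtain ⟨e, he, hsmall⟩ := exists_sub_d_mem_smallChains hU hW hz
      (by rw [hdz]; exact Submodule.zero_mem _)
    obtain ⟨a, ha, b, hb, hab⟩ := Submodule.mem_sup.1 hsmall
    have hdab : d a + d b = 0 := by rw [← map_add, hab, map_sub, hdz, d_d, sub_zero]
    refine ⟨⟨(a, -b), ⟨ha, Submodule.neg_mem _ hb⟩, ?_⟩, ?_⟩
    · change d a - d (-b) = 0
      rw [map_neg, sub_neg_eq_add, hdab]
    · refine (Submodule.Quotient.eq _).2 ?_
      change a - -b - z ∈ boundariesIn (U ∪ W) (k + 1)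
      rw [sub_neg_eq_add, hab, sub_sub_cancel_left]
      exact Submodule.neg_mem _ ⟨e, he, rfl⟩
  · intro y
    obtain ⟨⟨z, hz, hdz⟩, rfl⟩ := Submodule.mkQ_surjective _ y
    rw [chainsIn_inter] at hz
    obtain ⟨a, ha, haz⟩ := hUa k ⟨hz.1, hdz⟩
    obtain ⟨b, hb, hbz⟩ := hWa k ⟨hz.2, hdz⟩
    refine ⟨⟨(a, b), ⟨ha, hb⟩, ?_⟩, ?_⟩
    · change d a - d b = 0
      rw [haz, hbz, sub_self]
    · refine (Submodule.Quotient.eq _).2 ?_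
      change d a - z ∈ boundariesIn (U ∩ W) k
      rw [haz, sub_self]
      exact Submodule.zero_mem _
  · intro x
    obtain ⟨h1, h2, h3⟩ := hP x
    refine (hFker x).trans (Iff.trans ?_ (hGker x).symm)
    constructor
    · rintro ⟨e, he, hde⟩
      have hsm : d e ∈ smallChains U W (k + 1) := by
        rw [hde]
        exact Submodule.sub_mem _ (Submodule.mem_sup_left h1) (Submodule.mem_sup_right h2)
      obtain ⟨e', he', hsmall⟩ := exists_sub_d_mem_smallChains hU hW he hsm
      obtain ⟨a, ha, b, hb, hab⟩ := Submodule.mem_sup.1 hsmall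
      have hdab : d a + d b = x.1.1 - x.1.2 := by
        rw [← map_add, hab, map_sub, d_d, sub_zero, hde]
      -- Corrected by boundaries, `x.1.1` and `x.1.2` become equal, hence a chain in `U ∩ W`.
      have heq : x.1.1 - d a = x.1.2 + d b := by
        rw [sub_eq_iff_eq_add, add_assoc, add_comm (d b), hdab]
        abel
      refine ⟨x.1.1 - d a, ?_, by rw [map_sub, d_d, sub_zero]⟩
      change _ ∈ chainsIn (U ∩ W) (k + 1)
      rw [chainsIn_inter]
      refine ⟨Submodule.sub_mem _ h1 (d_mem_chainsIn ha), ?_⟩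
      rw [heq]
      exact Submodule.add_mem _ h2 (d_mem_chainsIn hb)
    · rintro ⟨c, hc, hdc⟩
      replace hc : c ∈ chainsIn (U ∩ W) (k + 1) := hc
      rw [chainsIn_inter] at hc
      obtain ⟨a, ha, hda⟩ := hUa (k + 1) (show x.1.1 - c ∈ cyclesIn U (k + 1) from
        ⟨Submodule.sub_mem _ h1 hc.1, by
          change d (x.1.1 - c) = 0
          rw [map_sub, hdc, sub_self]⟩)
      obtain ⟨b, hb, hdb⟩ := hWa (k + 1) (show x.1.2 - c ∈ cyclesIn W (k + 1) from
        ⟨Submodule.sub_mem _ h2 hc.2, by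
          change d (x.1.2 - c) = 0
          rw [map_sub, hdc, h3, sub_self]⟩)
      refine ⟨a - b, Submodule.sub_mem _ (chainsIn_mono Set.subset_union_left ha)
          (chainsIn_mono Set.subset_union_right hb), ?_⟩
      rw [map_sub, hda, hdb]
      abel

theorem nonempty_augHomology_empty_equiv :
    Nonempty (AugHomology (∅ : Set X) 0 ≃+ ℤ) := by
  have hbot : (boundariesIn (∅ : Set X) 0).submoduleOf (cyclesIn ∅ 0) = ⊥ := by
    rw [eq_bot_iff]
    rintro ⟨x, hx⟩ ⟨c, hc, hcx⟩
    have hc0 : c = 0 := by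
      have : {σ : C(stdSimplex ℝ (Fin (0 + 1)), X) | Set.range σ ⊆ ∅} = ∅ := by
        ext σ
        simp only [Set.subset_empty_iff, Set.range_eq_empty_iff, Set.mem_ofPred_eq,
          Set.mem_empty_iff_false, iff_false, not_isEmpty_iff]
        infer_instance
      change c ∈ supported ℤ ℤ _ at hc
      rw [this, supported_empty] at hc
      exact hc
    rw [hc0, map_zero] at hcx
    exact Subtype.ext hcx.symm
  have hemp : IsEmpty (stdSimplex ℝ (Fin 0)) :=
    ⟨fun x => by simpa using stdSimplex.sum_eq_one x⟩
  have htop : cyclesIn (∅ : Set X) 0 = ⊤ := by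
    rw [eq_top_iff]
    rintro c -
    refine ⟨?_, trivial⟩
    have : {σ : C(stdSimplex ℝ (Fin 0), X) | Set.range σ ⊆ ∅} = Set.univ := by
      ext σ
      simp only [Set.subset_empty_iff, Set.range_eq_empty_iff, Set.mem_ofPred_eq, Set.mem_univ,
        iff_true]
      exact hemp
    change c ∈ supported ℤ ℤ _
    rw [this, supported_univ]
    trivial
  let _ : Unique C(stdSimplex ℝ (Fin 0), X) :=
    ⟨⟨⟨fun x => hemp.elim x, by fun_prop⟩⟩, fun σ => ContinuousMap.ext fun x => hemp.elim x⟩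
  exact ⟨(Submodule.quotEquivOfEqBot _ hbot ≪≫ₗ LinearEquiv.ofEq _ _ htop ≪≫ₗ
    Submodule.topEquiv ≪≫ₗ Finsupp.uniqueLinearEquiv ℤ ℤ default).toAddEquiv⟩

end SingularChain

end

noncomputable section

open Finsupp CategoryTheory Simplicial

universe v

/-! ### Homology classes of chain complexes of modules, elementwise -/

namespace ChainComplex

variable {R : Type*} [Ring R] (K : ChainComplex (ModuleCat.{v} R) ℕ) (n : ℕ)

/-- The cycles of degree `n` as a submodule of the chains. For `n = 0` the differential out of degree
`0` is zero by convention, and every chain is a cycle. -/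
def cycleSubmodule : Submodule R (K.X n) :=
  LinearMap.ker (K.d n ((ComplexShape.down ℕ).next n)).hom

theorem mem_cycleSubmodule_zero (x : K.X 0) : x ∈ K.cycleSubmodule 0 := by
  rw [cycleSubmodule, LinearMap.mem_ker, K.shape _ _ (by simp)]
  rfl

theorem mem_cycleSubmodule_succ {n : ℕ} {x : K.X (n + 1)} :
    x ∈ K.cycleSubmodule (n + 1) ↔ (K.d (n + 1) n).hom x = 0 := by
  rw [cycleSubmodule, LinearMap.mem_ker, ComplexShape.next_eq' _ (show
    (ComplexShape.down ℕ).Rel (n + 1) n from rfl)]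

/-- The map from the submodule of cycles to the categorical object of cycles. -/
def liftCycleSubmodule : ModuleCat.of R (K.cycleSubmodule n) ⟶ K.cycles n :=
  K.liftCycles (ModuleCat.ofHom (K.cycleSubmodule n).subtype) _ rfl (by ext x; exact x.2)

theorem iCycles_liftCycleSubmodule (x : K.cycleSubmodule n) :
    (K.iCycles n).hom ((K.liftCycleSubmodule n).hom x) = x.1 :=
  ConcreteCategory.congr_hom (K.liftCycles_i (ModuleCat.ofHom (K.cycleSubmodule n).subtype) _ rfl
    (by ext x; exact x.2)) x

/-- The homology class of a cycle. -/
def homologyClass : K.cycleSubmodule n →ₗ[R] K.homology n :=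
  (K.liftCycleSubmodule n ≫ K.homologyπ n).hom

theorem iCycles_injective : Function.Injective (K.iCycles n).hom :=
  (ModuleCat.mono_iff_injective _).1 inferInstance

theorem homologyClass_surjective : Function.Surjective (K.homologyClass n) := by
  intro y
  obtain ⟨z, rfl⟩ := (ModuleCat.epi_iff_surjective (K.homologyπ n)).1 inferInstance y
  refine ⟨⟨(K.iCycles n).hom z, ?_⟩, ?_⟩
  · exact ConcreteCategory.congr_hom (K.iCycles_d n _) z
  · change (K.homologyπ n).hom ((K.liftCycleSubmodule n).hom _) = _
    congr 1
    apply K.iCycles_injective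
    rw [iCycles_liftCycleSubmodule]

theorem homologyClass_eq_zero_iff (x : K.cycleSubmodule n) :
    K.homologyClass n x = 0 ↔ ∃ y : K.X (n + 1), (K.d (n + 1) n).hom y = x.1 := by
  have hi : ∀ y, (K.iCycles n).hom ((K.toCycles (n + 1) n).hom y) = (K.d (n + 1) n).hom y :=
    fun y => ConcreteCategory.congr_hom (K.toCycles_i (n + 1) n) y
  constructor
  · intro h
    have hex : (ShortComplex.mk _ _ (K.toCycles_comp_homologyπ (n + 1) n)).Exact :=
      ShortComplex.exact_of_g_is_cokernel _ (K.homologyIsCokernel (n + 1) n (by simp))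
    obtain ⟨y, hy⟩ := (ShortComplex.moduleCat_exact_iff _).1 hex _ h
    refine ⟨y, ?_⟩
    rw [← hi, ← iCycles_liftCycleSubmodule]
    exact congrArg _ hy
  · rintro ⟨y, hy⟩
    have : (K.liftCycleSubmodule n).hom x = (K.toCycles (n + 1) n).hom y := by
      apply K.iCycles_injective
      rw [iCycles_liftCycleSubmodule, hi, hy]
    change (K.homologyπ n).hom ((K.liftCycleSubmodule n).hom x) = 0
    rw [this]
    exact ConcreteCategory.congr_hom (K.toCycles_comp_homologyπ (n + 1) n) y

variable {K} {L : ChainComplex (ModuleCat.{v} R) ℕ}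

theorem homologyMap_homologyClass (g : K ⟶ L) (x : K.cycleSubmodule n) (y : L.cycleSubmodule n)
    (hxy : (g.f n).hom x.1 = y.1) :
    (HomologicalComplex.homologyMap g n).hom (K.homologyClass n x) = L.homologyClass n y := by
  have h1 := ConcreteCategory.congr_hom (HomologicalComplex.homologyπ_naturality g n)
    ((K.liftCycleSubmodule n).hom x)
  refine h1.trans ?_
  change (L.homologyπ n).hom ((HomologicalComplex.cyclesMap g n).hom _) =
    (L.homologyπ n).hom ((L.liftCycleSubmodule n).hom y)
  congr 1
  apply L.iCycles_injective
  rw [iCycles_liftCycleSubmodule, ← hxy, ← iCycles_liftCycleSubmodule]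
  exact ConcreteCategory.congr_hom (HomologicalComplex.cyclesMap_i g n) _

end ChainComplex

/-! ### The singular chain complex is free on the singular simplices -/

namespace SingularChain

variable {X Y : Type v} [TopologicalSpace X] [TopologicalSpace Y]

/-- The chain map induced by a continuous map. -/
def mapChain {X Y : Type*} [TopologicalSpace X] [TopologicalSpace Y] {k : ℕ} (g : C(X, Y)) :
    SingularChain X k →ₗ[ℤ] SingularChain Y k :=
  lmapDomain ℤ ℤ fun σ => g.comp σ

theorem mapChain_single {X Y : Type*} [TopologicalSpace X] [TopologicalSpace Y] {k : ℕ}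
    (g : C(X, Y)) (σ : C(stdSimplex ℝ (Fin k), X)) :
    mapChain g (single σ 1) = single (g.comp σ) 1 := by
  simp [mapChain]

theorem mapChain_d {X Y : Type*} [TopologicalSpace X] [TopologicalSpace Y] {k : ℕ}
    (g : C(X, Y)) (c : SingularChain X (k + 1)) : mapChain g (d c) = d (mapChain g c) := by
  suffices h : mapChain g ∘ₗ d (k := k) = d ∘ₗ mapChain g from LinearMap.congr_fun h c
  refine hom_ext fun σ => ?_
  simp only [LinearMap.comp_apply, d_single, mapChain_single, map_sum, map_zsmul,
    ContinuousMap.comp_assoc]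

variable (X) in
/-- Mathlib's singular chain complex of `X`, with coefficients `ULift ℤ`. -/
abbrev singularComplex : ChainComplex (ModuleCat.{v} ℤ) ℕ :=
  (TopCat.toSSet.obj (TopCat.of X)).chainComplex (ModuleCat.of ℤ (ULift.{v} ℤ))

/-- The map from Mathlib's singular chains of degree `n` to the chains with `n + 1` vertices. -/
def ofComplexHom (n : ℕ) :
    (singularComplex X).X n ⟶ ModuleCat.of ℤ (SingularChain X (n + 1)) :=
  ((TopCat.toSSet.obj (TopCat.of X)).isColimitChainComplexXCofan
    (ModuleCat.of ℤ (ULift.{v} ℤ)) n).desc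
    (Limits.Cofan.mk _ fun x => ModuleCat.ofHom
      (lsingle ((TopCat.of X).toSSetObjEquiv _ x) ∘ₗ ULift.moduleEquiv.toLinearMap))

/-- The generator of Mathlib's singular chain complex at the simplex `x`. -/
abbrev basisElement {n : ℕ} (x : (TopCat.toSSet.obj (TopCat.of X)) _⦋n⦌) :
    (singularComplex X).X n :=
  ((TopCat.toSSet.obj (TopCat.of X)).ιChainComplex
    (R := ModuleCat.of ℤ (ULift.{v} ℤ)) x).hom ⟨1⟩

theorem complex_hom_ext {n : ℕ} {M : Type v} [AddCommGroup M] [Module ℤ M]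
    {F G : (singularComplex X).X n →ₗ[ℤ] M}
    (h : ∀ x, F (basisElement x) = G (basisElement x)) : F = G := by
  have : ModuleCat.ofHom F = ModuleCat.ofHom G := by
    refine SSet.chainComplex_hom_ext fun x => ?_
    ext m
    obtain ⟨m⟩ := m
    have hm : (ULift.up m : ULift.{v} ℤ) = m • (ULift.up 1 : ULift.{v} ℤ) := by
      ext
      simp
    simp only [hm, map_zsmul]
    congr 1
    exact h x
  exact congrArg ModuleCat.Hom.hom this

theorem ofComplexHom_basisElement {n : ℕ} (x : (TopCat.toSSet.obj (TopCat.of X)) _⦋n⦌) :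
    (ofComplexHom n).hom (basisElement x) =
      single ((TopCat.of X).toSSetObjEquiv _ x : C(stdSimplex ℝ (Fin (n + 1)), X)) 1 :=
  ConcreteCategory.congr_hom (((TopCat.toSSet.obj (TopCat.of X)).isColimitChainComplexXCofan
    (ModuleCat.of ℤ (ULift.{v} ℤ)) n).fac _ ⟨x⟩) (ULift.up 1)

/-- The inverse of `ofComplexHom`. -/
def toComplex (n : ℕ) : SingularChain X (n + 1) →ₗ[ℤ] (singularComplex X).X n :=
  linearCombination ℤ fun σ => basisElement (((TopCat.of X).toSSetObjEquiv (.op ⦋n⦌)).symm σ)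

theorem toComplex_single {n : ℕ} (σ : C(stdSimplex ℝ (Fin (n + 1)), X)) :
    toComplex n (single σ 1) =
      basisElement (((TopCat.of X).toSSetObjEquiv (.op ⦋n⦌)).symm σ) := by
  rw [toComplex, linearCombination_single]
  exact @one_smul ℤ _ _ ((singularComplex X).X n).isModule.toMulAction _

/-- Mathlib's singular chains of degree `n`, a coproduct of copies of the coefficients, are the
finitely supported functions on the singular simplices with `n + 1` vertices. -/
def complexEquiv (X : Type v) [TopologicalSpace X] (n : ℕ) :
    (singularComplex X).X n ≃ₗ[ℤ] SingularChain X (n + 1) :=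
  LinearEquiv.ofLinearMap (ofComplexHom n).hom (toComplex n)
    (hom_ext fun σ => by
      rw [LinearMap.comp_apply, toComplex_single, ofComplexHom_basisElement]
      simp)
    (complex_hom_ext fun x => by
      rw [LinearMap.comp_apply, ofComplexHom_basisElement, toComplex_single]
      simp)

theorem complexEquiv_basisElement {n : ℕ} (x : (TopCat.toSSet.obj (TopCat.of X)) _⦋n⦌) :
    complexEquiv X n (basisElement x) =
      single ((TopCat.of X).toSSetObjEquiv _ x : C(stdSimplex ℝ (Fin (n + 1)), X)) 1 :=
  ofComplexHom_basisElement x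

theorem complexEquiv_d {n : ℕ} (x : (singularComplex X).X (n + 1)) :
    complexEquiv X n (((singularComplex X).d (n + 1) n).hom x) =
      d (complexEquiv X (n + 1) x) := by
  suffices h : (complexEquiv X n).toLinearMap ∘ₗ ((singularComplex X).d (n + 1) n).hom =
    d ∘ₗ (complexEquiv X (n + 1)).toLinearMap from LinearMap.congr_fun h x
  refine complex_hom_ext fun x => ?_
  have h1 : ((singularComplex X).d (n + 1) n).hom (basisElement x) =
      ∑ i : Fin (n + 2), (-1 : ℤ) ^ i.val •
        basisElement ((TopCat.toSSet.obj (TopCat.of X)).δ i x) := by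
    have := ConcreteCategory.congr_hom (SSet.ιChainComplex_d
      (X := TopCat.toSSet.obj (TopCat.of X)) (R := ModuleCat.of ℤ (ULift.{v} ℤ)) x) (ULift.up 1)
    refine this.trans ?_
    simp [ModuleCat.hom_sum]
  simp only [LinearMap.comp_apply, LinearEquiv.coe_coe, h1, map_sum, map_zsmul,
    complexEquiv_basisElement, d_single]
  rfl

theorem complexEquiv_map {n : ℕ} (g : C(X, Y)) (x : (singularComplex X).X n) :
    complexEquiv Y n (((SSet.chainComplexMap (TopCat.toSSet.map (TopCat.ofHom g))
      (ModuleCat.of ℤ (ULift.{v} ℤ))).f n).hom x) = mapChain g (complexEquiv X n x) := by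
  suffices h : (complexEquiv Y n).toLinearMap ∘ₗ
    ((SSet.chainComplexMap (TopCat.toSSet.map (TopCat.ofHom g))
      (ModuleCat.of ℤ (ULift.{v} ℤ))).f n).hom = mapChain g ∘ₗ (complexEquiv X n).toLinearMap from
    LinearMap.congr_fun h x
  refine complex_hom_ext fun x => ?_
  have h1 : ((SSet.chainComplexMap (TopCat.toSSet.map (TopCat.ofHom g))
      (ModuleCat.of ℤ (ULift.{v} ℤ))).f n).hom (basisElement x) =
      basisElement ((TopCat.toSSet.map (TopCat.ofHom g)).app _ x) :=
    ConcreteCategory.congr_hom (SSet.ι_chainComplexMap_f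
      (R := ModuleCat.of ℤ (ULift.{v} ℤ)) (f := TopCat.toSSet.map (TopCat.ofHom g)) (x := x))
      (ULift.up 1)
  simp only [LinearMap.comp_apply, LinearEquiv.coe_coe, h1,
    complexEquiv_basisElement, mapChain_single]
  rfl

end SingularChain

end

noncomputable section

open Finsupp CategoryTheory

universe v

/-! ### Reduced homology as the homology of the augmented complex -/

namespace SingularChain

/-- The augmented complex of a point is exact. -/
theorem exists_d_eq_of_subsingleton {Y : Type*} [TopologicalSpace Y] [Subsingleton Y] [Nonempty Y]
    {k : ℕ} (c : SingularChain Y (k + 1)) (hc : d c = 0) : ∃ e, d e = c := by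
  let y : Y := Classical.arbitrary Y
  let h (k : ℕ) : SingularChain Y k →ₗ[ℤ] SingularChain Y (k + 1) :=
    lmapDomain ℤ ℤ fun _ => ContinuousMap.const _ y
  have hs : ∀ k σ, h k (single σ 1) = single (ContinuousMap.const _ y) 1 := fun k σ => by
    simp [h]
  have hsub : ∀ (k) (σ τ : C(stdSimplex ℝ (Fin k), Y)), σ = τ := fun k σ τ =>
    ContinuousMap.ext fun _ => Subsingleton.elim _ _
  have key : d ∘ₗ h (k + 1) = LinearMap.id - h k ∘ₗ d := by
    refine hom_ext fun σ => ?_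
    simp only [LinearMap.comp_apply, LinearMap.sub_apply, LinearMap.id_apply, hs, d_single,
      map_sum, map_zsmul]
    rw [Fin.sum_univ_succ, Fin.val_zero, pow_zero, one_smul,
      hsub _ ((ContinuousMap.const _ y).comp (simplexFace 0)) σ, sub_eq_add_neg,
      ← Finset.sum_neg_distrib]
    congr 1
    refine Finset.sum_congr rfl fun i _ => ?_
    rw [hsub _ ((ContinuousMap.const _ y).comp (simplexFace i.succ)) (ContinuousMap.const _ y),
      Fin.val_succ, pow_succ, mul_neg_one, neg_smul]
  refine ⟨h (k + 1) c, ?_⟩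
  have := LinearMap.congr_fun key c
  simpa [hc] using this

variable {X Y : Type v} [TopologicalSpace X] [TopologicalSpace Y]

theorem mapChain_injective {X Y : Type*} [TopologicalSpace X] [TopologicalSpace Y] {k : ℕ}
    {g : C(X, Y)} (hg : Function.Injective g) :
    Function.Injective (mapChain (k := k) g) :=
  mapDomain_injective fun _ _ h => ContinuousMap.ext fun t => hg (DFunLike.congr_fun h t)

theorem mapChain_zero_injective {X Y : Type*} [TopologicalSpace X] [TopologicalSpace Y]
    (g : C(X, Y)) : Function.Injective (mapChain (k := 0) g) :=
  mapDomain_injective fun _ _ _ => ContinuousMap.ext fun t => by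
    simpa using stdSimplex.sum_eq_one t

theorem exists_d_eq_iff {n : ℕ} {x : (singularComplex X).X n} :
    (∃ y, ((singularComplex X).d (n + 1) n).hom y = x) ↔ ∃ e, d e = complexEquiv X n x := by
  constructor
  · rintro ⟨y, rfl⟩
    exact ⟨complexEquiv X (n + 1) y, (complexEquiv_d y).symm⟩
  · rintro ⟨e, he⟩
    refine ⟨(complexEquiv X (n + 1)).symm e, (complexEquiv X n).injective ?_⟩
    rw [complexEquiv_d, LinearEquiv.apply_symm_apply, he]

theorem mem_cycleSubmodule_of_d_eq_zero {n : ℕ} {x : (singularComplex X).X n}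
    (h : d (complexEquiv X n x) = 0) : x ∈ (singularComplex X).cycleSubmodule n := by
  cases n with
  | zero => exact ChainComplex.mem_cycleSubmodule_zero _ x
  | succ n =>
    rw [ChainComplex.mem_cycleSubmodule_succ]
    apply (complexEquiv X n).injective
    rw [complexEquiv_d, h, map_zero]

/-- The class of a chain is killed by the map to a point exactly if its augmented boundary vanishes.
This says something only for `n = 0`, since in positive degrees both sides always hold. -/
theorem homologyClass_mem_reducedHomology_iff {n : ℕ}
    (x : (singularComplex X).cycleSubmodule n) :
    (singularComplex X).homologyClass n x ∈ reducedHomology n X ↔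
      d (complexEquiv X n x.1) = 0 := by
  let p : C(X, PUnit.{v + 1}) := ContinuousMap.const X PUnit.unit
  let P := SSet.chainComplexMap (TopCat.toSSet.map (TopCat.ofHom p)) (ModuleCat.of ℤ (ULift.{v} ℤ))
  have hPx : (P.f n).hom x.1 ∈ (singularComplex PUnit.{v + 1}).cycleSubmodule n := by
    cases n with
    | zero => exact ChainComplex.mem_cycleSubmodule_zero _ _
    | succ n =>
      rw [ChainComplex.mem_cycleSubmodule_succ]
      have hx := (ChainComplex.mem_cycleSubmodule_succ _).1 x.2
      apply (complexEquiv _ n).injective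
      rw [complexEquiv_d, complexEquiv_map, ← mapChain_d, ← complexEquiv_d, hx]
      simp
  have h1 : (singularComplex X).homologyClass n x ∈ reducedHomology n X ↔
      (singularComplex PUnit.{v + 1}).homologyClass n ⟨_, hPx⟩ = 0 := by
    rw [← ChainComplex.homologyMap_homologyClass n P x ⟨_, hPx⟩ rfl]
    exact Iff.rfl
  rw [h1, ChainComplex.homologyClass_eq_zero_iff, exists_d_eq_iff, complexEquiv_map]
  constructor
  · rintro ⟨e, he⟩
    cases n with
    | zero =>
      apply mapChain_zero_injective p
      rw [mapChain_d, ← he, d_d, map_zero]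
    | succ n =>
      have hx := (ChainComplex.mem_cycleSubmodule_succ _).1 x.2
      rw [← complexEquiv_d, hx, map_zero]
  · intro h
    refine exists_d_eq_of_subsingleton _ ?_
    rw [← mapChain_d, h, map_zero]

/-- The reduced homology class of a cycle of the augmented complex. -/
def reducedClass (n : ℕ) : LinearMap.ker (d (X := X) (k := n)) →+ reducedHomology n X where
  toFun c := ⟨(singularComplex X).homologyClass n ⟨(complexEquiv X n).symm c.1,
      mem_cycleSubmodule_of_d_eq_zero (by rw [LinearEquiv.apply_symm_apply]; exact c.2)⟩,
    (homologyClass_mem_reducedHomology_iff _).2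
      (by rw [LinearEquiv.apply_symm_apply]; exact c.2)⟩
  map_zero' := Subtype.ext (by
    refine (congrArg ((singularComplex X).homologyClass n) (Subtype.ext ?_)).trans (map_zero ((singularComplex X).homologyClass n))
    exact map_zero _)
  map_add' c e := Subtype.ext (by
    refine (congrArg ((singularComplex X).homologyClass n) (Subtype.ext ?_)).trans (map_add ((singularComplex X).homologyClass n) _ _)
    exact map_add _ _ _)

theorem reducedClass_eq_zero_iff {n : ℕ} (c : LinearMap.ker (d (X := X) (k := n))) :
    reducedClass n c = 0 ↔ ∃ e, d e = c.1 := by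
  have h : reducedClass n c = 0 ↔ (singularComplex X).homologyClass n
      ⟨(complexEquiv X n).symm c.1, mem_cycleSubmodule_of_d_eq_zero
        (by rw [LinearEquiv.apply_symm_apply]; exact c.2)⟩ = 0 :=
    Subtype.ext_iff
  rw [h, ChainComplex.homologyClass_eq_zero_iff, exists_d_eq_iff, LinearEquiv.apply_symm_apply]

theorem reducedClass_surjective (n : ℕ) :
    Function.Surjective (reducedClass (X := X) n) := by
  rintro ⟨y, hy⟩
  obtain ⟨x, rfl⟩ := (singularComplex X).homologyClass_surjective n y
  refine ⟨⟨complexEquiv X n x.1, (homologyClass_mem_reducedHomology_iff x).1 hy⟩,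
    Subtype.ext (congrArg ((singularComplex X).homologyClass n) (Subtype.ext ?_))⟩
  exact (complexEquiv X n).symm_apply_apply _

/-! ### Chains of a subspace -/

section Subspace

variable {Z : Type*} [TopologicalSpace Z]

theorem mapChain_val_mem_chainsIn {S : Set Z} {k : ℕ} (c : SingularChain S k) :
    mapChain (⟨Subtype.val, continuous_subtype_val⟩ : C(S, Z)) c ∈ chainsIn S k := by
  refine map_mem_of_mem_supported (s := Set.univ) (fun σ _ => ?_) (by simp)
  rw [mapChain_single]
  refine single_mem_chainsIn ?_
  rintro _ ⟨t, rfl⟩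
  exact (σ t).2

theorem exists_mapChain_val_eq {S : Set Z} {k : ℕ} {c : SingularChain Z k}
    (hc : c ∈ chainsIn S k) :
    ∃ e : SingularChain S k, mapChain (⟨Subtype.val, continuous_subtype_val⟩ : C(S, Z)) e = c := by
  refine map_mem_of_mem_supported (F := LinearMap.id)
    (N := LinearMap.range (mapChain (⟨Subtype.val, continuous_subtype_val⟩ : C(S, Z))))
    (fun σ hσ => ?_) hc
  refine ⟨single ⟨fun t => ⟨σ t, hσ ⟨t, rfl⟩⟩, by fun_prop⟩ 1, ?_⟩
  rw [mapChain_single]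
  rfl

end Subspace

theorem nonempty_augHomology_equiv_reducedHomology (S : Set X) (n : ℕ) :
    Nonempty (AugHomology S (n + 1) ≃+ reducedHomology n S) := by
  let i : C(S, X) := ⟨Subtype.val, continuous_subtype_val⟩
  have hi : ∀ {k : ℕ}, Function.Injective (mapChain (k := k) i) := fun {k} =>
    mapChain_injective (g := i) Subtype.val_injective
  let F : LinearMap.ker (d (X := S) (k := n)) →ₗ[ℤ] AugHomology S (n + 1) :=
    Submodule.mkQ _ ∘ₗ LinearMap.codRestrict (cyclesIn S (n + 1))
      (mapChain i ∘ₗ Submodule.subtype _) fun c => ⟨mapChain_val_mem_chainsIn _, by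
        change d (mapChain i c.1) = 0
        rw [← mapChain_d, c.2, map_zero]⟩
  have hFker : ∀ c, F c = 0 ↔ mapChain i c.1 ∈ boundariesIn S (n + 1) := fun c =>
    Submodule.Quotient.mk_eq_zero _
  refine nonempty_addEquiv_of_ker_eq (F := F.toAddMonoidHom) (G := reducedClass n) ?_
    (reducedClass_surjective n) ?_
  · intro y
    obtain ⟨⟨z, hz, hdz⟩, rfl⟩ := Submodule.mkQ_surjective _ y
    obtain ⟨e, he⟩ := exists_mapChain_val_eq hz
    refine ⟨⟨e, hi ?_⟩, ?_⟩
    · rw [mapChain_d, map_zero]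
      exact (congrArg d he).trans hdz
    · refine (Submodule.Quotient.eq _).2 ?_
      change mapChain i e - z ∈ boundariesIn S (n + 1)
      rw [show mapChain i e = z from he, sub_self]
      exact Submodule.zero_mem _
  · intro c
    refine (hFker c).trans (Iff.trans ?_ (reducedClass_eq_zero_iff c).symm)
    constructor
    · rintro ⟨e, he, hde⟩
      obtain ⟨e', rfl⟩ := exists_mapChain_val_eq he
      refine ⟨e', hi ?_⟩
      rw [mapChain_d]
      exact hde
    · rintro ⟨e, he⟩
      refine ⟨mapChain i e, mapChain_val_mem_chainsIn _, ?_⟩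
      rw [← mapChain_d, he]

/-! ### Homotopy invariance -/

theorem singularHomologyMap_comp {X Y Z : Type v} [TopologicalSpace X] [TopologicalSpace Y]
    [TopologicalSpace Z] (n : ℕ) (g : C(Y, Z)) (h : C(X, Y)) (x : singularHomology n X) :
    singularHomologyMap n (g.comp h) x = singularHomologyMap n g (singularHomologyMap n h x) := by
  unfold singularHomologyMap
  rw [TopCat.ofHom_comp, Functor.map_comp]
  rfl

theorem singularHomologyMap_id (n : ℕ) (x : singularHomology n X) :
    singularHomologyMap n (ContinuousMap.id X) x = x := by
  unfold singularHomologyMap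
  rw [TopCat.ofHom_id, CategoryTheory.Functor.map_id]
  rfl

theorem singularHomologyMap_eq_of_homotopic (n : ℕ) {g h : C(X, Y)} (H : g.Homotopic h) :
    singularHomologyMap n g = singularHomologyMap n h := by
  obtain ⟨H⟩ := H
  have H' : TopCat.Homotopy (TopCat.ofHom g) (TopCat.ofHom h) := H
  exact congrArg ModuleCat.Hom.hom (H'.congr_homologyMap_singularChainComplexFunctor
    (ModuleCat.of ℤ (ULift.{v} ℤ)) n)

theorem singularHomologyMap_mem_reducedHomology {n : ℕ} (g : C(X, Y)) {x : singularHomology n X}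
    (hx : x ∈ reducedHomology n X) : singularHomologyMap n g x ∈ reducedHomology n Y := by
  change singularHomologyMap n _ (singularHomologyMap n g x) = 0
  rw [← singularHomologyMap_comp]
  exact hx

/-- The map that a continuous map induces on reduced homology. -/
def reducedHomologyMap (n : ℕ) (g : C(X, Y)) : reducedHomology n X →+ reducedHomology n Y where
  toFun x := ⟨singularHomologyMap n g x.1, singularHomologyMap_mem_reducedHomology g x.2⟩
  map_zero' := Subtype.ext (map_zero _)
  map_add' _ _ := Subtype.ext (map_add _ _ _)

/-- Homotopy equivalent spaces have isomorphic reduced homology. -/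
def reducedHomologyEquiv (n : ℕ) (e : ContinuousMap.HomotopyEquiv X Y) :
    reducedHomology n X ≃+ reducedHomology n Y :=
  AddMonoidHom.toAddEquiv (reducedHomologyMap n e.toFun) (reducedHomologyMap n e.invFun)
    (AddMonoidHom.ext fun x => Subtype.ext (by
      change singularHomologyMap n _ (singularHomologyMap n _ x.1) = x.1
      rw [← singularHomologyMap_comp, singularHomologyMap_eq_of_homotopic n e.left_inv,
        singularHomologyMap_id]))
    (AddMonoidHom.ext fun x => Subtype.ext (by
      change singularHomologyMap n _ (singularHomologyMap n _ x.1) = x.1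
      rw [← singularHomologyMap_comp, singularHomologyMap_eq_of_homotopic n e.right_inv,
        singularHomologyMap_id]))

theorem singularHomologyMap_eq_zero_of_nullhomotopic {n : ℕ} {g : C(X, Y)} (hg : g.Nullhomotopic)
    {x : singularHomology n X} (hx : x ∈ reducedHomology n X) : singularHomologyMap n g x = 0 := by
  obtain ⟨y, hy⟩ := hg
  have : ContinuousMap.const X y =
      (ContinuousMap.const PUnit.{v + 1} y).comp (ContinuousMap.const X PUnit.unit) := rfl
  rw [singularHomologyMap_eq_of_homotopic n hy, this, singularHomologyMap_comp]
  have hx' : singularHomologyMap n (ContinuousMap.const X PUnit.unit.{v + 1}) x = 0 := hx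
  rw [hx', map_zero]

theorem isAcyclic_of_contractibleSpace (S : Set X) [ContractibleSpace S] : IsAcyclic S := by
  intro k
  cases k with
  | zero =>
    obtain ⟨s⟩ : Nonempty S := inferInstance
    rintro c -
    refine map_mem_of_mem_supported (F := LinearMap.id) (s := Set.univ) (fun σ _ => ?_) (by simp)
    refine ⟨single (ContinuousMap.const _ s.1) 1, single_mem_chainsIn ?_, ?_⟩
    · rintro _ ⟨t, rfl⟩
      exact s.2
    · have : ∀ τ : C(stdSimplex ℝ (Fin 0), X), τ = σ := fun τ => ContinuousMap.ext fun t => by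
        simpa using stdSimplex.sum_eq_one t
      rw [d_single]
      simp [this]
  | succ n =>
    obtain ⟨e⟩ := nonempty_augHomology_equiv_reducedHomology S n
    have h0 : ∀ x : reducedHomology n S, x = 0 := by
      rintro ⟨x, hx⟩
      exact Subtype.ext ((singularHomologyMap_id n x).symm.trans
        (singularHomologyMap_eq_zero_of_nullhomotopic (id_nullhomotopic S) hx))
    intro c hc
    have : Submodule.Quotient.mk
        (p := (boundariesIn S (n + 1)).submoduleOf (cyclesIn S (n + 1))) ⟨c, hc⟩ = 0 := by
      apply e.injective
      rw [h0 (e _), map_zero]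
    exact (Submodule.Quotient.mk_eq_zero
      ((boundariesIn S (n + 1)).submoduleOf (cyclesIn S (n + 1)))).1 this

/-! ### The complement of a linear subspace -/

section Compl

variable {V : Type v} [AddCommGroup V] [Module ℝ V]
  [TopologicalSpace V] [IsTopologicalAddGroup V] [ContinuousSMul ℝ V]

theorem isAcyclic_setOf_mem_imp_pos (L : Submodule ℝ V) (α : Module.Dual ℝ V) {p : V}
    (hp : p ∈ L) (hαp : 0 < α p) : IsAcyclic {x : V | x ∈ L → 0 < α x} := by
  have hstar : StarConvex ℝ p {x : V | x ∈ L → 0 < α x} := by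
    intro x hx a b ha hb hab hmem
    rw [map_add, map_smul, map_smul, smul_eq_mul, smul_eq_mul]
    rcases hb.eq_or_lt with rfl | hb
    · have : a = 1 := by linarith
      subst this
      simpa using hαp
    · have hbx : b • x ∈ L := by
        have := L.sub_mem hmem (L.smul_mem a hp)
        rwa [add_sub_cancel_left] at this
      have hxL : x ∈ L := by
        have := L.smul_mem b⁻¹ hbx
        rwa [smul_smul, inv_mul_cancel₀ hb.ne', one_smul] at this
      have := hx hxL
      positivity
  have : ContractibleSpace {x : V | x ∈ L → 0 < α x} :=
    hstar.contractibleSpace ⟨p, fun _ => hαp⟩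
  exact isAcyclic_of_contractibleSpace _

variable [FiniteDimensional ℝ V] [T2Space V]

theorem isOpen_setOf_mem_imp_pos (L : Submodule ℝ V) (α : Module.Dual ℝ V) :
    IsOpen {x : V | x ∈ L → 0 < α x} := by
  have h : {x : V | x ∈ L → 0 < α x} = (L : Set V)ᶜ ∪ {x | 0 < α x} := by
    ext x
    simp [imp_iff_not_or]
  rw [h]
  exact L.closed_of_finiteDimensional.isOpen_compl.union
    (isOpen_lt continuous_const α.continuous_of_finiteDimensional)

/-- The complement of a linear subspace of codimension `r` has the reduced homology of the sphere of
dimension `r - 1` in degree `r - 1`. The induction starts at `r = 0`, with the empty complement. -/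
theorem nonempty_augHomology_compl_equiv (r : ℕ) (L : Submodule ℝ V)
    (hL : Module.finrank ℝ L + r = Module.finrank ℝ V) :
    Nonempty (AugHomology ((L : Set V)ᶜ) r ≃+ ℤ) := by
  induction r generalizing L with
  | zero =>
    have : L = ⊤ := Submodule.eq_top_of_finrank_eq hL
    subst this
    rw [Submodule.top_coe, Set.compl_univ]
    exact nonempty_augHomology_empty_equiv
  | succ r ih =>
    have hne : L ≠ ⊤ := by
      rintro rfl
      rw [finrank_top] at hL
      omega
    obtain ⟨p, -, hp⟩ := SetLike.exists_of_lt (lt_top_iff_ne_top.2 hne)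
    obtain ⟨α, hα⟩ := Submodule.exists_le_ker_of_notMem hp
    obtain ⟨hαp, hαL⟩ := hα
    wlog hpos : 0 < α p generalizing α
    · exact this (-α) (by simpa using hαp) (fun x hx => by simpa using hαL hx)
        (by
          have := lt_of_le_of_ne (not_lt.1 hpos) hαp
          simpa using this)
    -- `L` is cut out of `L' = L ⊕ ℝ p` by `α`.
    let L' := L ⊔ Submodule.span ℝ {p}
    have hpL' : p ∈ L' := Submodule.mem_sup_right (Submodule.mem_span_singleton_self p)
    have hL' : ∀ x, x ∈ L ↔ x ∈ L' ∧ α x = 0 := by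
      intro x
      constructor
      · exact fun hx => ⟨Submodule.mem_sup_left hx, hαL hx⟩
      · rintro ⟨hx, hx0⟩
        obtain ⟨y, hy, z, hz, rfl⟩ := Submodule.mem_sup.1 hx
        obtain ⟨t, rfl⟩ := Submodule.mem_span_singleton.1 hz
        have hy0 : α y = 0 := hαL hy
        rw [map_add, hy0, map_smul, zero_add, smul_eq_mul] at hx0
        rcases mul_eq_zero.1 hx0 with rfl | h
        · simpa using hy
        · exact absurd h hαp
    have hdim : Module.finrank ℝ L' + r = Module.finrank ℝ V := by
      have h1 := Submodule.finrank_sup_add_finrank_inf_eq L (Submodule.span ℝ {p})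
      have hp0 : p ≠ 0 := fun h => hp (h ▸ L.zero_mem)
      have h2 : L ⊓ Submodule.span ℝ {p} = ⊥ := by
        rw [← _root_.disjoint_iff]
        exact (Submodule.disjoint_span_singleton' hp0).2 hp
      rw [h2, finrank_bot, finrank_span_singleton hp0] at h1
      change Module.finrank ℝ L' + 0 = _ at h1
      omega
    obtain ⟨e⟩ := ih L' hdim
    have hU := isOpen_setOf_mem_imp_pos L' α
    have hW := isOpen_setOf_mem_imp_pos L' (-α)
    obtain ⟨e'⟩ := nonempty_augHomology_union_equiv hU hW
      (isAcyclic_setOf_mem_imp_pos L' α hpL' hpos)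
      (isAcyclic_setOf_mem_imp_pos L' (-α) (L'.neg_mem hpL') (by simpa using hpos)) r
    have hunion : {x : V | x ∈ L' → 0 < α x} ∪ {x : V | x ∈ L' → 0 < (-α) x} =
        (L : Set V)ᶜ := by
      ext x
      simp only [Set.mem_union, Set.mem_ofPred_eq, LinearMap.neg_apply, Left.neg_pos_iff,
        Set.mem_compl_iff, SetLike.mem_coe, hL' x]
      by_cases hx : x ∈ L'
      · simp only [hx, true_implies, true_and]
        rw [or_comm]
        exact ne_iff_lt_or_gt.symm
      · simp [hx]
    have hinter : {x : V | x ∈ L' → 0 < α x} ∩ {x : V | x ∈ L' → 0 < (-α) x} =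
        (L' : Set V)ᶜ := by
      ext x
      simp only [Set.mem_inter_iff, Set.mem_ofPred_eq, LinearMap.neg_apply, Left.neg_pos_iff,
        Set.mem_compl_iff, SetLike.mem_coe]
      constructor
      · rintro ⟨h1, h2⟩ hx
        exact lt_asymm (h1 hx) (h2 hx)
      · exact fun h => ⟨fun hx => absurd hx h, fun hx => absurd hx h⟩
    rw [hunion, hinter] at e'
    exact ⟨e'.trans e⟩

theorem nonempty_reducedHomology_compl_equiv (n : ℕ) (L : Submodule ℝ V)
    (hL : Module.finrank ℝ L + (n + 1) = Module.finrank ℝ V) :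
    Nonempty (reducedHomology n ((L : Set V)ᶜ : Set V) ≃+ ℤ) := by
  obtain ⟨e⟩ := nonempty_augHomology_compl_equiv (n + 1) L hL
  obtain ⟨e'⟩ := nonempty_augHomology_equiv_reducedHomology ((L : Set V)ᶜ) n
  exact ⟨e'.symm.trans e⟩

end Compl

end SingularChain

end

noncomputable section

open Filter Topology

universe u

/-! ### Signs of chambers -/

namespace CentralArrangement

variable {V : Type u} [AddCommGroup V] [Module ℝ V]

/-- A linear functional with kernel `H`. -/
def form (A : CentralArrangement V) (H : A.hyperplanes) : Module.Dual ℝ V :=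
  (A.isHyperplane H.1 H.2).choose

theorem form_ne_zero (A : CentralArrangement V) (H : A.hyperplanes) : A.form H ≠ 0 :=
  (A.isHyperplane H.1 H.2).choose_spec.1

theorem form_apply_eq_zero_iff (A : CentralArrangement V) (H : A.hyperplanes) (x : V) :
    A.form H x = 0 ↔ x ∈ H.1 := by
  conv_rhs => rw [← (A.isHyperplane H.1 H.2).choose_spec.2]
  exact LinearMap.mem_ker.symm

theorem mem_complement_iff (A : CentralArrangement V) {x : V} :
    x ∈ A.complement ↔ ∀ H, A.form H x ≠ 0 := by
  simp only [ne_eq, form_apply_eq_zero_iff]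
  exact ⟨fun h H => h H.1 H.2, fun h H hH => h ⟨H, hH⟩⟩

theorem mem_complement_single_iff (A : CentralArrangement V) {H : A.hyperplanes} {x : V} :
    x ∈ (A.single H).complement ↔ A.form H x ≠ 0 := by
  rw [ne_eq, form_apply_eq_zero_iff]
  exact ⟨fun h => h H.1 (Finset.mem_singleton_self _), fun h K hK => by
    rwa [Finset.mem_singleton.1 hK]⟩

theorem mem_center_iff (A : CentralArrangement V) {x : V} :
    x ∈ (A.hyperplanes.inf id : Submodule ℝ V) ↔ ∀ H, A.form H x = 0 := by
  simp only [form_apply_eq_zero_iff, Submodule.mem_finsetInf, id]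
  exact ⟨fun h H => h H.1 H.2, fun h H hH => h ⟨H, hH⟩⟩

theorem exists_mem_complement (A : CentralArrangement V) : ∃ x, x ∈ A.complement := by
  obtain ⟨x, hx⟩ := Module.Dual.exists_forall_ne_zero_of_forall_exists A.form fun H => by
    by_contra! h
    exact A.form_ne_zero H (LinearMap.ext h)
  exact ⟨x, A.mem_complement_iff.2 hx⟩

theorem convex_setOf_mul_pos (α : Module.Dual ℝ V) (a : ℝ) : Convex ℝ {z | 0 < a * α z} := by
  have h := convex_halfSpace_gt (𝕜 := ℝ) (a • α).isLinear 0
  exact h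

variable [TopologicalSpace V]

/-- The chamber of a point of the complement. -/
def chamberOf (A : CentralArrangement V) {x : V} (hx : x ∈ A.complement) : A.Chamber :=
  ⟨connectedComponentIn A.complement x, x, hx, rfl⟩

theorem form_point_ne_zero (A : CentralArrangement V) (H : A.hyperplanes) (c : A.Chamber) :
    A.form H c.point ≠ 0 :=
  A.mem_complement_iff.1 c.point_mem_complement H

/-- The side of `H` on which the chamber `c` lies, as the sign `1` or `-1` of `A.form H` on `c`. -/
def chamberSign (A : CentralArrangement V) (H : A.hyperplanes) (c : A.Chamber) : ℝ :=
  if 0 < A.form H c.point then 1 else -1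

theorem chamberSign_eq_one_or (A : CentralArrangement V) (H : A.hyperplanes) (c : A.Chamber) :
    A.chamberSign H c = 1 ∨ A.chamberSign H c = -1 := by
  unfold chamberSign
  split_ifs <;> simp

theorem chamberSign_mul_form_point (A : CentralArrangement V) (H : A.hyperplanes)
    (c : A.Chamber) : A.chamberSign H c * A.form H c.point = |A.form H c.point| := by
  unfold chamberSign
  split_ifs with h
  · rw [abs_of_pos h, one_mul]
  · rw [abs_of_nonpos (not_lt.1 h), neg_one_mul]

theorem abs_chamberSign_mul (A : CentralArrangement V) (H : A.hyperplanes) (c : A.Chamber)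
    (a : ℝ) : |A.chamberSign H c * a| = |a| := by
  rcases A.chamberSign_eq_one_or H c with h | h <;> simp [h]

theorem chamberSign_eq_of_pos (A : CentralArrangement V) {H : A.hyperplanes} {c d : A.Chamber}
    {a : ℝ} (hc : 0 < A.chamberSign H c * a) (hd : 0 < A.chamberSign H d * a) :
    A.chamberSign H c = A.chamberSign H d := by
  rcases A.chamberSign_eq_one_or H c with h | h <;>
    rcases A.chamberSign_eq_one_or H d with h' | h' <;> rw [h] at hc ⊢ <;> rw [h'] at hd ⊢ <;>
    linarith

theorem mul_form_point_pos_iff (A : CentralArrangement V) (H : A.hyperplanes) (c d : A.Chamber) :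
    0 < A.form H c.point * A.form H d.point ↔ A.chamberSign H c = A.chamberSign H d := by
  have hc := A.form_point_ne_zero H c
  have hd := A.form_point_ne_zero H d
  unfold chamberSign
  split_ifs with h1 h2 h2
  · simp [mul_pos h1 h2]
  · have := mul_neg_of_pos_of_neg h1 (lt_of_le_of_ne (not_lt.1 h2) hd)
    norm_num
    exact this.le
  · have := mul_neg_of_neg_of_pos (lt_of_le_of_ne (not_lt.1 h1) hc) h2
    norm_num
    exact this.le
  · simpa using mul_pos_of_neg_of_neg (lt_of_le_of_ne (not_lt.1 h1) hc)
      (lt_of_le_of_ne (not_lt.1 h2) hd)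

section

variable [IsTopologicalAddGroup V] [ContinuousSMul ℝ V]

theorem mem_connectedComponentIn_single (A : CentralArrangement V) {H : A.hyperplanes} {x y : V}
    (h : 0 < A.form H x * A.form H y) :
    y ∈ connectedComponentIn (A.single H).complement x := by
  have hx : A.form H x ≠ 0 := fun h0 => by simp [h0] at h
  refine (convex_setOf_mul_pos (A.form H) (A.form H x)).isPreconnected.subset_connectedComponentIn
    (mul_self_pos.2 hx) (fun z hz => ?_) h
  rw [mem_complement_single_iff]
  intro h0
  simp [h0] at hz

theorem mem_connectedComponentIn_complement (A : CentralArrangement V) {x y : V}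
    (h : ∀ H, 0 < A.form H x * A.form H y) : y ∈ connectedComponentIn A.complement x := by
  have hx : ∀ H, A.form H x ≠ 0 := fun H h0 => by simpa [h0] using h H
  have hconv : Convex ℝ (⋂ H, {z | 0 < A.form H x * A.form H z}) :=
    convex_iInter fun H => convex_setOf_mul_pos (A.form H) (A.form H x)
  refine hconv.isPreconnected.subset_connectedComponentIn
    (Set.mem_iInter.2 fun H => mul_self_pos.2 (hx H)) (fun z hz => ?_) (Set.mem_iInter.2 h)
  rw [mem_complement_iff]
  intro H h0
  have := Set.mem_iInter.1 hz H
  simp [h0] at this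

theorem chamber_eq_of_chamberSign_eq (A : CentralArrangement V) {c d : A.Chamber}
    (h : ∀ H, A.chamberSign H c = A.chamberSign H d) : c = d := by
  apply Subtype.ext
  rw [← c.component_point, ← d.component_point]
  exact connectedComponentIn_eq (A.mem_connectedComponentIn_complement fun H =>
    (A.mul_form_point_pos_iff H c d).2 (h H))

theorem eq_eps_of_mul_form_pos (A : CentralArrangement V) {H : A.hyperplanes} {c : A.Chamber}
    {e : (A.single H).Chamber} (h : 0 < A.form H c.point * A.form H e.point) :
    e = A.eps H c := by
  apply Subtype.ext
  rw [← e.component_point]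
  exact (connectedComponentIn_eq (A.mem_connectedComponentIn_single h)).symm

variable [FiniteDimensional ℝ V] [T2Space V]

theorem mul_form_pos_of_mem_connectedComponentIn (A : CentralArrangement V) {H : A.hyperplanes}
    {x y : V} (hx : A.form H x ≠ 0) (h : y ∈ connectedComponentIn (A.single H).complement x) :
    0 < A.form H x * A.form H y := by
  have hα : Continuous (A.form H) := (A.form H).continuous_of_finiteDimensional
  have hpre := (isPreconnected_connectedComponentIn (x := x)
    (F := (A.single H).complement)).image _ hα.continuousOn
  have hord := hpre.ordConnected
  have hxm : A.form H x ∈ A.form H '' connectedComponentIn (A.single H).complement x :=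
    ⟨x, mem_connectedComponentIn (A.mem_complement_single_iff.2 hx), rfl⟩
  have hym : A.form H y ∈ A.form H '' connectedComponentIn (A.single H).complement x :=
    ⟨y, h, rfl⟩
  have h0 : (0 : ℝ) ∉ A.form H '' connectedComponentIn (A.single H).complement x := by
    rintro ⟨z, hz, hz0⟩
    exact A.mem_complement_single_iff.1 (connectedComponentIn_subset _ _ hz) hz0
  by_contra hneg
  rcases mul_nonpos_iff.1 (not_lt.1 hneg) with ⟨h1, h2⟩ | ⟨h1, h2⟩
  · exact h0 (hord.out hym hxm ⟨h2, h1⟩)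
  · exact h0 (hord.out hxm hym ⟨h1, h2⟩)

theorem chamberSign_chamberOf_mul_form_pos (A : CentralArrangement V) {x : V}
    (hx : x ∈ A.complement) (H : A.hyperplanes) :
    0 < A.chamberSign H (A.chamberOf hx) * A.form H x := by
  have h1 : x ∈ connectedComponentIn A.complement (A.chamberOf hx).point := by
    rw [(A.chamberOf hx).component_point]
    exact mem_connectedComponentIn hx
  have h2 := A.mul_form_pos_of_mem_connectedComponentIn (A.form_point_ne_zero H (A.chamberOf hx))
    (connectedComponentIn_mono _ (A.complement_subset_single H) h1)
  unfold chamberSign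
  split_ifs with h
  · rw [one_mul]
    exact pos_of_mul_pos_right h2 h.le
  · rw [neg_one_mul, neg_pos]
    exact neg_of_mul_pos_right h2 (not_lt.1 h)

theorem eps_eq_iff (A : CentralArrangement V) (H : A.hyperplanes) (c d : A.Chamber) :
    A.eps H c = A.eps H d ↔ A.chamberSign H c = A.chamberSign H d := by
  rw [← mul_form_point_pos_iff]
  constructor
  · intro h
    refine A.mul_form_pos_of_mem_connectedComponentIn (A.form_point_ne_zero H c) ?_
    have h' : (A.eps H c).1 = (A.eps H d).1 := congrArg Subtype.val h
    change d.point ∈ (A.eps H c).1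
    rw [h']
    exact mem_connectedComponentIn (A.complement_subset_single H d.point_mem_complement)
  · intro h
    exact Subtype.ext (connectedComponentIn_eq (A.mem_connectedComponentIn_single h))

/-- The chamber `-c`. -/
def opposite (A : CentralArrangement V) (c : A.Chamber) : A.Chamber :=
  A.chamberOf (x := -c.point) (A.mem_complement_iff.2 fun H => by
    simpa using A.form_point_ne_zero H c)

theorem eps_opposite_ne (A : CentralArrangement V) (H : A.hyperplanes) (c : A.Chamber) :
    A.eps H (A.opposite c) ≠ A.eps H c := by
  rw [ne_eq, eps_eq_iff]
  intro h
  have h1 := A.chamberSign_chamberOf_mul_form_pos (x := -c.point) (A.mem_complement_iff.2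
    fun H => by simpa using A.form_point_ne_zero H c) H
  change 0 < A.chamberSign H (A.opposite c) * _ at h1
  rw [h, map_neg, mul_neg, chamberSign_mul_form_point] at h1
  exact absurd h1 (by simp)

theorem eq_eps_or_eq_eps_opposite (A : CentralArrangement V) (H : A.hyperplanes) (c : A.Chamber)
    (e : (A.single H).Chamber) : e = A.eps H c ∨ e = A.eps H (A.opposite c) := by
  have he : A.form H e.point ≠ 0 := A.mem_complement_single_iff.1 e.point_mem_complement
  have hopp : A.form H c.point * A.form H (A.opposite c).point < 0 := by
    have h1 := A.eps_opposite_ne H c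
    rw [ne_comm, ne_eq, eps_eq_iff, ← mul_form_point_pos_iff, not_lt] at h1
    exact lt_of_le_of_ne h1
      (mul_ne_zero (A.form_point_ne_zero H c) (A.form_point_ne_zero H _))
  rcases lt_or_gt_of_ne (mul_ne_zero (A.form_point_ne_zero H c) he) with h | h
  · right
    apply A.eq_eps_of_mul_form_pos
    have h3 := mul_pos_of_neg_of_neg h hopp
    have h4 : A.form H c.point * A.form H e.point *
        (A.form H c.point * A.form H (A.opposite c).point) =
        (A.form H c.point) ^ 2 * (A.form H (A.opposite c).point * A.form H e.point) := by ring
    rw [h4] at h3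
    exact pos_of_mul_pos_right h3 (sq_nonneg _)
  · left
    exact A.eq_eps_of_mul_form_pos h

/-- A chamber that has `v` in its closure lies, up to `δ`, on the same side of every hyperplane as
`v`. It is the chamber of `v + t q` for a generic `q` and small `t > 0`. -/
theorem exists_chamber_near (A : CentralArrangement V) (v : V) {δ : ℝ} (hδ : 0 < δ) :
    ∃ c : A.Chamber, ∀ H, -δ < A.chamberSign H c * A.form H v := by
  obtain ⟨q, hq⟩ := A.exists_mem_complement
  have hev : ∀ᶠ t : ℝ in 𝓝[>] 0, ∀ H, A.form H (v + t • q) ≠ 0 ∧ |A.form H (t • q)| < δ := by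
    rw [eventually_all]
    intro H
    have hqH := A.mem_complement_iff.1 hq H
    have hc : Continuous fun t : ℝ => A.form H (t • q) := by
      simp only [map_smul, smul_eq_mul]
      fun_prop
    refine Eventually.and ?_ ?_
    · by_cases hv : A.form H v = 0
      · filter_upwards [self_mem_nhdsWithin] with t ht
        rw [map_add, hv, zero_add, map_smul, smul_eq_mul]
        exact mul_ne_zero (ne_of_gt ht) hqH
      · refine nhdsWithin_le_nhds ?_
        have hc' : ContinuousAt (fun t : ℝ => A.form H v + A.form H (t • q)) 0 :=
          (continuous_const.add hc).continuousAt
        simp only [map_add]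
        exact hc'.eventually_ne (by simpa using hv)
    · refine nhdsWithin_le_nhds ?_
      exact hc.abs.continuousAt.eventually_lt continuousAt_const (by simpa using hδ)
  obtain ⟨t, ht⟩ := hev.exists
  refine ⟨A.chamberOf (A.mem_complement_iff.2 fun H => (ht H).1), fun H => ?_⟩
  have h1 := A.chamberSign_chamberOf_mul_form_pos (A.mem_complement_iff.2 fun H => (ht H).1) H
  have h2 := (ht H).2
  rw [← A.abs_chamberSign_mul H (A.chamberOf (A.mem_complement_iff.2 fun H => (ht H).1))] at h2
  rw [map_add, mul_add] at h1
  have h3 := (abs_lt.1 h2).2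
  linarith

end

end CentralArrangement

end

noncomputable section

open Filter Topology

universe u

/-! ### The realization of `M₁(A)` and the complement of the center -/

/-- Two maps into a realization are homotopic if at every point their values lie in a common face. -/
theorem Realization.homotopic_of_forall_face {ι : Type u} [Fintype ι]
    {K : PreAbstractSimplicialComplex ι} {X : Type*} [TopologicalSpace X]
    (f g : C(X, Realization K))
    (h : ∀ x, ∃ s ∈ K.faces, (∀ i, i ∉ s → (f x).1 i = 0) ∧ ∀ i, i ∉ s → (g x).1 i = 0) :
    f.Homotopic g := by
  have hconv := convex_stdSimplex ℝ ι
  refine ⟨⟨⟨fun p => ⟨⟨(1 - (p.1 : ℝ)) • (f p.2).1.1 + (p.1 : ℝ) • (g p.2).1.1,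
    hconv (f p.2).1.2 (g p.2).1.2 (sub_nonneg.2 p.1.2.2) p.1.2.1 (by ring)⟩, ?_⟩, ?_⟩, ?_, ?_⟩⟩
  · obtain ⟨s, hs, h1, h2⟩ := h p.2
    refine ⟨s, hs, fun i hi => ?_⟩
    have h1' : (f p.2).1.1 i = 0 := h1 i hi
    have h2' : (g p.2).1.1 i = 0 := h2 i hi
    change (1 - (p.1 : ℝ)) * (f p.2).1.1 i + (p.1 : ℝ) * (g p.2).1.1 i = 0
    rw [h1', h2', mul_zero, mul_zero, add_zero]
  · refine Continuous.subtype_mk (Continuous.subtype_mk ?_ _) _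
    have hf : Continuous fun p : unitInterval × X => (f p.2).1.1 :=
      continuous_subtype_val.comp (continuous_subtype_val.comp (f.continuous.comp continuous_snd))
    have hg : Continuous fun p : unitInterval × X => (g p.2).1.1 :=
      continuous_subtype_val.comp (continuous_subtype_val.comp (g.continuous.comp continuous_snd))
    have ht : Continuous fun p : unitInterval × X => (p.1 : ℝ) :=
      continuous_subtype_val.comp continuous_fst
    exact ((continuous_const.sub ht).smul hf).add (ht.smul hg)
  · intro x
    apply Subtype.ext
    apply Subtype.ext
    simp
  · intro x
    apply Subtype.ext
    apply Subtype.ext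
    simp

theorem homotopic_of_forall_segment_subset {E X : Type*} [AddCommGroup E] [Module ℝ E]
    [TopologicalSpace E] [ContinuousAdd E] [ContinuousSMul ℝ E] [TopologicalSpace X] {S : Set E}
    (f g : C(X, S)) (h : ∀ x, segment ℝ (f x).1 (g x).1 ⊆ S) : f.Homotopic g := by
  refine ⟨⟨⟨fun p => ⟨(1 - (p.1 : ℝ)) • (f p.2).1 + (p.1 : ℝ) • (g p.2).1,
    h p.2 ⟨1 - p.1, p.1, sub_nonneg.2 p.1.2.2, p.1.2.1, by ring, rfl⟩⟩, ?_⟩, ?_, ?_⟩⟩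
  · refine Continuous.subtype_mk ?_ _
    have hf : Continuous fun p : unitInterval × X => (f p.2).1 :=
      continuous_subtype_val.comp (f.continuous.comp continuous_snd)
    have hg : Continuous fun p : unitInterval × X => (g p.2).1 :=
      continuous_subtype_val.comp (g.continuous.comp continuous_snd)
    have ht : Continuous fun p : unitInterval × X => (p.1 : ℝ) :=
      continuous_subtype_val.comp continuous_fst
    exact ((continuous_const.sub ht).smul hf).add (ht.smul hg)
  · intro x
    apply Subtype.ext
    simp
  · intro x
    apply Subtype.ext
    simp

namespace CentralArrangement

variable {V : Type u} [AddCommGroup V] [Module ℝ V]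

/-- The largest absolute value of a functional `A.form H` at `v`; it vanishes exactly on the
intersection of the hyperplanes. -/
def formNorm (A : CentralArrangement V) (v : V) : ℝ := ‖fun H => A.form H v‖

/-- The tolerance in the choice of the chambers near `v`, positive outside the intersection of the
hyperplanes. There it is less than `|A.form H v|` for some `H`, and less than `μ`, which will be a
lower bound for all `|A.form H c.point|`. -/
def threshold (A : CentralArrangement V) (μ : ℝ) (v : V) : ℝ := min (A.formNorm v) μ / 2

theorem formNorm_pos (A : CentralArrangement V) {v : V}
    (hv : v ∉ (A.hyperplanes.inf id : Submodule ℝ V)) : 0 < A.formNorm v := by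
  refine norm_pos_iff.2 fun h => hv ?_
  rw [mem_center_iff]
  exact fun H => congrFun h H

theorem threshold_pos (A : CentralArrangement V) {μ : ℝ} (hμ : 0 < μ) {v : V}
    (hv : v ∉ (A.hyperplanes.inf id : Submodule ℝ V)) : 0 < A.threshold μ v :=
  half_pos (lt_min (A.formNorm_pos hv) hμ)

theorem exists_threshold_le_abs_form (A : CentralArrangement V) {μ : ℝ} (hμ : 0 < μ) {v : V}
    (hv : v ∉ (A.hyperplanes.inf id : Submodule ℝ V)) :
    ∃ H, A.threshold μ v ≤ |A.form H v| := by
  by_contra! h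
  have h1 := A.formNorm_pos hv
  have h2 : A.formNorm v ≤ A.threshold μ v :=
    (pi_norm_le_iff_of_nonneg (A.threshold_pos hμ hv).le).2 fun H => (h H).le
  have h3 : A.threshold μ v ≤ A.formNorm v / 2 :=
    div_le_div_of_nonneg_right (min_le_left _ _) two_pos.le
  linarith

variable [TopologicalSpace V]

/-- An unnormalized weight of the chamber `c` that depends continuously on `v`. It is nonzero exactly
if, up to `A.threshold μ v`, the chamber lies on the same side of every hyperplane as `v`. -/
def nearWeight (A : CentralArrangement V) (μ : ℝ) (v : V) (c : A.Chamber) : ℝ :=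
  ∏ H, max 0 (A.chamberSign H c * A.form H v + A.threshold μ v)

theorem nearWeight_nonneg (A : CentralArrangement V) (μ : ℝ) (v : V) (c : A.Chamber) :
    0 ≤ A.nearWeight μ v c :=
  Finset.prod_nonneg fun _ _ => le_max_left _ _

theorem chamberSign_mul_pos_of_nearWeight_ne_zero (A : CentralArrangement V) {μ : ℝ} (hμ : 0 < μ)
    {v : V} (hv : v ∉ (A.hyperplanes.inf id : Submodule ℝ V)) {c : A.Chamber} {H : A.hyperplanes}
    (hH : A.threshold μ v ≤ |A.form H v|) (hc : A.nearWeight μ v c ≠ 0) :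
    0 < A.chamberSign H c * A.form H v := by
  have h1 := Finset.prod_ne_zero_iff.1 hc H (Finset.mem_univ H)
  have h2 : 0 < A.chamberSign H c * A.form H v + A.threshold μ v := by
    by_contra h
    exact h1 (max_eq_left (not_lt.1 h))
  rw [← A.abs_chamberSign_mul H c] at hH
  have h3 := A.threshold_pos hμ hv
  by_contra h
  rw [abs_of_nonpos (not_lt.1 h)] at hH
  linarith

variable [IsTopologicalAddGroup V] [ContinuousSMul ℝ V]

open Classical in
/-- The chambers on the same side of `H` as `c`. These are the maximal faces of `M₁(A)`. -/
def halfFace (A : CentralArrangement V) (H : A.hyperplanes) (c : A.Chamber) : Finset A.Chamber :=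
  Finset.univ.filter fun d => A.chamberSign H d = A.chamberSign H c

theorem mem_halfFace (A : CentralArrangement V) {H : A.hyperplanes} {c d : A.Chamber} :
    d ∈ A.halfFace H c ↔ A.chamberSign H d = A.chamberSign H c := by
  simp [halfFace]

/-- The combination of the points of the chambers with coefficients `w`. -/
def toAmbient (A : CentralArrangement V) (w : A.Chamber → ℝ) : V := ∑ c, w c • c.point

theorem continuous_toAmbient (A : CentralArrangement V) : Continuous A.toAmbient :=
  continuous_finsetSum _ fun c _ => (continuous_apply c).smul continuous_const

/-- If the chambers with nonzero coefficient lie on one side of `H`, then so does their combination,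
and it is at least as far from `H` as the nearest of the points of the chambers. -/
theorem le_sign_mul_form_toAmbient (A : CentralArrangement V) {w : A.Chamber → ℝ}
    (hw : w ∈ stdSimplex ℝ A.Chamber) {H : A.hyperplanes} {s μ : ℝ}
    (hs : ∀ c, w c ≠ 0 → A.chamberSign H c = s) (hμ : ∀ c : A.Chamber, μ ≤ |A.form H c.point|) :
    μ ≤ s * A.form H (A.toAmbient w) := by
  have h1 : s * A.form H (A.toAmbient w) = ∑ c, w c * (s * A.form H c.point) := by
    rw [toAmbient, map_sum, Finset.mul_sum]
    refine Finset.sum_congr rfl fun c _ => ?_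
    rw [map_smul, smul_eq_mul]
    ring
  have h2 : μ = ∑ c, w c * μ := by rw [← Finset.sum_mul, hw.2, one_mul]
  rw [h1, h2]
  refine Finset.sum_le_sum fun c _ => ?_
  by_cases hc : w c = 0
  · simp [hc]
  · rw [← hs c hc, chamberSign_mul_form_point]
    exact mul_le_mul_of_nonneg_left (hμ c) (hw.1 c)

theorem exists_le_abs_form_point (A : CentralArrangement V) :
    ∃ μ : ℝ, 0 < μ ∧ ∀ H (c : A.Chamber), μ ≤ |A.form H c.point| := by
  rcases isEmpty_or_nonempty (A.hyperplanes × A.Chamber) with h | h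
  · exact ⟨1, one_pos, fun H c => h.elim (H, c)⟩
  · obtain ⟨⟨H, c⟩, hmin⟩ := Finite.exists_min
      fun p : A.hyperplanes × A.Chamber => |A.form p.1 p.2.point|
    exact ⟨_, abs_pos.2 (A.form_point_ne_zero H c), fun H' c' => hmin (H', c')⟩

variable [FiniteDimensional ℝ V] [T2Space V]

theorem sum_nearWeight_pos (A : CentralArrangement V) {μ : ℝ} (hμ : 0 < μ)
    {v : V} (hv : v ∉ (A.hyperplanes.inf id : Submodule ℝ V)) :
    0 < ∑ c, A.nearWeight μ v c := by
  obtain ⟨c, hc⟩ := A.exists_chamber_near v (A.threshold_pos hμ hv)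
  refine Finset.sum_pos' (fun c _ => A.nearWeight_nonneg μ v c) ⟨c, Finset.mem_univ c, ?_⟩
  refine Finset.prod_pos fun H _ => lt_max_of_lt_right ?_
  linarith [hc H]

theorem halfFace_mem_faces (A : CentralArrangement V) (H : A.hyperplanes) (c : A.Chamber) :
    A.halfFace H c ∈ A.M.faces := by
  refine ⟨⟨c, A.mem_halfFace.2 rfl⟩, H, ?_⟩
  rw [Separates, Set.not_nontrivial_iff]
  rintro _ ⟨d, hd, rfl⟩ _ ⟨e, he, rfl⟩
  rw [eps_eq_iff, A.mem_halfFace.1 hd, A.mem_halfFace.1 he]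

theorem exists_chamberSign_eq (A : CentralArrangement V) (w : Realization A.M) :
    ∃ H c, ∀ d, w.1 d ≠ 0 → A.chamberSign H d = A.chamberSign H c := by
  obtain ⟨w, s, ⟨⟨c, hc⟩, H, hH⟩, hw⟩ := w
  rw [Separates, Set.not_nontrivial_iff] at hH
  refine ⟨H, c, fun d hd => ?_⟩
  rw [← eps_eq_iff]
  refine hH ⟨d, ?_, rfl⟩ ⟨c, hc, rfl⟩
  by_contra h
  exact hd (hw d h)

theorem toAmbient_notMem_center (A : CentralArrangement V) (w : Realization A.M) :
    A.toAmbient w.1.1 ∉ (A.hyperplanes.inf id : Submodule ℝ V) := by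
  obtain ⟨μ, hμ, hle⟩ := A.exists_le_abs_form_point
  obtain ⟨H, c, hHc⟩ := A.exists_chamberSign_eq w
  have h1 := A.le_sign_mul_form_toAmbient w.1.2 hHc (hle H)
  rw [mem_center_iff]
  intro h
  rw [h H, mul_zero] at h1
  linarith

theorem continuous_nearWeight (A : CentralArrangement V) (μ : ℝ) (c : A.Chamber) :
    Continuous fun v => A.nearWeight μ v c := by
  have hform : ∀ H, Continuous (A.form H) := fun H => (A.form H).continuous_of_finiteDimensional
  have hnorm : Continuous A.formNorm := (continuous_pi hform).norm
  have hthr : Continuous (A.threshold μ) := (hnorm.min continuous_const).div_const 2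
  exact continuous_finsetProd _ fun H _ =>
    continuous_const.max ((continuous_const.mul (hform H)).add hthr)

/-- The complement of the intersection of the hyperplanes. -/
abbrev CenterCompl (A : CentralArrangement V) : Set V :=
  ((A.hyperplanes.inf id : Submodule ℝ V) : Set V)ᶜ

/-- The map `|M₁(A)| → V ∖ ⋂ H`. -/
def toCenterCompl (A : CentralArrangement V) : C(Realization A.M, A.CenterCompl) where
  toFun w := ⟨A.toAmbient w.1.1, A.toAmbient_notMem_center w⟩
  continuous_toFun := (A.continuous_toAmbient.comp
    (continuous_subtype_val.comp continuous_subtype_val)).subtype_mk _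

/-- The map `V ∖ ⋂ H → |M₁(A)|` with barycentric coordinates proportional to `A.nearWeight μ v`. The
chambers with nonzero weight lie on one side of the hyperplane farthest from `v`, so they form a
face. -/
def ofCenterCompl (A : CentralArrangement V) {μ : ℝ} (hμ : 0 < μ) :
    C(A.CenterCompl, Realization A.M) where
  toFun v := ⟨⟨fun c => A.nearWeight μ v.1 c / ∑ d, A.nearWeight μ v.1 d,
      fun c => div_nonneg (A.nearWeight_nonneg μ v.1 c) (A.sum_nearWeight_pos hμ v.2).le, by
        rw [← Finset.sum_div]
        exact div_self (A.sum_nearWeight_pos hμ v.2).ne'⟩, by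
    obtain ⟨H, hH⟩ := A.exists_threshold_le_abs_form hμ v.2
    obtain ⟨c, -, hc⟩ := Finset.exists_ne_zero_of_sum_ne_zero (A.sum_nearWeight_pos hμ v.2).ne'
    refine ⟨A.halfFace H c, A.halfFace_mem_faces H c, fun d hd => ?_⟩
    by_contra h
    refine hd (A.mem_halfFace.2 (A.chamberSign_eq_of_pos
      (A.chamberSign_mul_pos_of_nearWeight_ne_zero hμ v.2 hH fun h0 => h ?_)
      (A.chamberSign_mul_pos_of_nearWeight_ne_zero hμ v.2 hH hc)))
    change A.nearWeight μ v.1 d / _ = 0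
    rw [h0, zero_div]⟩
  continuous_toFun := by
    refine Continuous.subtype_mk (Continuous.subtype_mk (continuous_pi fun c => ?_) _) _
    have h : ∀ c, Continuous fun v : A.CenterCompl => A.nearWeight μ v.1 c := fun c =>
      (A.continuous_nearWeight μ c).comp continuous_subtype_val
    exact (h c).div (continuous_finsetSum _ fun d _ => h d)
      fun v => (A.sum_nearWeight_pos hμ v.2).ne'

theorem nearWeight_ne_zero_of_ofCenterCompl (A : CentralArrangement V) {μ : ℝ} (hμ : 0 < μ)
    {v : A.CenterCompl} {c : A.Chamber} (hc : (A.ofCenterCompl hμ v).1 c ≠ 0) :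
    A.nearWeight μ v.1 c ≠ 0 := by
  intro h
  apply hc
  change A.nearWeight μ v.1 c / _ = 0
  rw [h, zero_div]

theorem nonempty_homotopyEquiv_centerCompl (A : CentralArrangement V) :
    Nonempty (ContinuousMap.HomotopyEquiv (Realization A.M) A.CenterCompl) := by
  obtain ⟨μ, hμ, hle⟩ := A.exists_le_abs_form_point
  refine ⟨⟨A.toCenterCompl, A.ofCenterCompl hμ, ?_, ?_⟩⟩
  · refine Realization.homotopic_of_forall_face _ _ fun w => ?_
    obtain ⟨H, c, hHc⟩ := A.exists_chamberSign_eq w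
    refine ⟨A.halfFace H c, A.halfFace_mem_faces H c, fun d hd => ?_, fun d hd => ?_⟩
    · by_contra h
      have h1 := A.le_sign_mul_form_toAmbient w.1.2 hHc (hle H)
      -- The tolerance at the image of `w` is below its distance to `H`, because of the bound `μ`.
      have hthr : A.threshold μ (A.toAmbient w.1.1) ≤ |A.form H (A.toAmbient w.1.1)| := by
        rw [← A.abs_chamberSign_mul H c]
        have h2 : A.threshold μ (A.toAmbient w.1.1) ≤ μ / 2 :=
          div_le_div_of_nonneg_right (min_le_right _ _) two_pos.le
        have h3 := le_abs_self (A.chamberSign H c * A.form H (A.toAmbient w.1.1))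
        linarith
      have h4 := A.chamberSign_mul_pos_of_nearWeight_ne_zero hμ (A.toAmbient_notMem_center w) hthr
        (A.nearWeight_ne_zero_of_ofCenterCompl hμ (v := A.toCenterCompl w) h)
      exact hd (A.mem_halfFace.2 (A.chamberSign_eq_of_pos h4 (lt_of_lt_of_le hμ h1)))
    · by_contra h
      exact hd (A.mem_halfFace.2 (hHc d h))
  · refine homotopic_of_forall_segment_subset _ _ fun v => ?_
    obtain ⟨H, hH⟩ := A.exists_threshold_le_abs_form hμ v.2
    obtain ⟨c, -, hc⟩ := Finset.exists_ne_zero_of_sum_ne_zero (A.sum_nearWeight_pos hμ v.2).ne'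
    have h1 := A.chamberSign_mul_pos_of_nearWeight_ne_zero hμ v.2 hH hc
    have h2 := A.le_sign_mul_form_toAmbient (A.ofCenterCompl hμ v).1.2
      (s := A.chamberSign H c) (fun d hd => A.chamberSign_eq_of_pos
        (A.chamberSign_mul_pos_of_nearWeight_ne_zero hμ v.2 hH
          (A.nearWeight_ne_zero_of_ofCenterCompl hμ hd)) h1) (hle H)
    have hconv : Convex ℝ {z : V | 0 < A.chamberSign H c * A.form H z} :=
      convex_setOf_mul_pos (A.form H) (A.chamberSign H c)
    refine (hconv.segment_subset (lt_of_lt_of_le hμ h2) h1).trans fun z hz hz0 => ?_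
    have hz' : 0 < A.chamberSign H c * A.form H z := hz
    rw [A.mem_center_iff.1 hz0 H, mul_zero] at hz'
    exact lt_irrefl _ hz'

/-- `H̃_{r-1}(|M₁(A)|; ℤ)` is infinite cyclic, where `r` is the rank. -/
theorem nonempty_reducedHomology_realization_equiv (A : CentralArrangement V) {n : ℕ}
    (hn : A.rank = n + 1) : Nonempty (reducedHomology n (Realization A.M) ≃+ ℤ) := by
  obtain ⟨e⟩ := A.nonempty_homotopyEquiv_centerCompl
  have hle := Submodule.finrank_le (A.hyperplanes.inf id : Submodule ℝ V)
  obtain ⟨e'⟩ := SingularChain.nonempty_reducedHomology_compl_equiv n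
    (A.hyperplanes.inf id : Submodule ℝ V) (by
      rw [rank] at hn
      omega)
  exact ⟨(SingularChain.reducedHomologyEquiv n e).trans e'⟩

end CentralArrangement

end

noncomputable section

universe u

/-! ### Maps satisfying IIA -/

theorem IsSwap.apply_ne {X : Type u} {φ : X → X} (h : IsSwap φ) (x : X) : φ x ≠ x := by
  obtain ⟨a, b, hab, hx, ha, hb⟩ := h
  rcases hx x with rfl | rfl
  · rw [ha]
    exact hab.symm
  · rw [hb]
    exact hab

theorem IsSwap.involutive {X : Type u} {φ : X → X} (h : IsSwap φ) : Function.Involutive φ := by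
  obtain ⟨a, b, -, hx, ha, hb⟩ := h
  intro x
  rcases hx x with rfl | rfl
  · rw [ha, hb]
  · rw [hb, ha]

theorem involutive_of_eq_id_or_isSwap {X : Type u} {φ : X → X} (h : φ = id ∨ IsSwap φ) :
    Function.Involutive φ := by
  rcases h with rfl | h
  · exact fun _ => rfl
  · exact h.involutive

theorem IsSimplicial.realize_apply_eq_zero {ι κ : Type u} [Fintype ι] [Fintype κ]
    {K : PreAbstractSimplicialComplex ι} {L : PreAbstractSimplicialComplex κ} {f : ι → κ}
    (hf : IsSimplicial K L f) (w : Realization K) {j : κ} (hj : ∀ i, f i ≠ j) :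
    (hf.realize w).1 j = 0 := by
  classical
  change stdSimplex.map f w.1 j = 0
  rw [stdSimplex.map_coe, FunOnFinite.linearMap_apply_apply]
  exact Finset.sum_eq_zero fun i hi => absurd (Finset.mem_filter.1 hi).2 (hj i)

/-- An automorphism of an infinite cyclic group is `1` or `-1`. -/
theorem Int.addEquiv_apply_eq_or {G : Type*} [AddCommGroup G] (e : G ≃+ ℤ) (T : G ≃+ G) :
    (∀ x, T x = x) ∨ ∀ x, T x = -x := by
  let S : ℤ ≃+ ℤ := e.symm.trans (T.trans e)
  have hS : ∀ m, S m = m * S 1 := fun m => by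
    have := map_zsmul S m 1
    simpa using this
  have hu : IsUnit (S 1) := by
    obtain ⟨m, hm⟩ := S.surjective 1
    rw [hS] at hm
    exact IsUnit.of_mul_eq_one_right m hm
  have hT : ∀ x, e (T x) = e x * S 1 := fun x => by
    rw [← hS]
    simp [S]
  rcases Int.isUnit_iff.1 hu with h | h
  · exact Or.inl fun x => e.injective (by rw [hT, h, mul_one])
  · exact Or.inr fun x => e.injective (by rw [hT, h, mul_neg_one, map_neg])

namespace CentralArrangement

variable {V : Type u} [AddCommGroup V] [Module ℝ V]

theorem isEmpty_hyperplanes_of_rank_eq_zero [FiniteDimensional ℝ V] {A : CentralArrangement V}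
    (h : A.rank = 0) : IsEmpty A.hyperplanes := by
  refine ⟨fun H => ?_⟩
  have hlt : (A.hyperplanes.inf id : Submodule ℝ V) < ⊤ := by
    rw [lt_top_iff_ne_top]
    intro htop
    refine A.form_ne_zero H (LinearMap.ext fun x => ?_)
    exact A.mem_center_iff.1 (htop ▸ Submodule.mem_top) H
  have := Submodule.finrank_lt hlt.ne
  rw [rank] at h
  omega

variable [TopologicalSpace V]

theorem nonempty_chamber (A : CentralArrangement V) : Nonempty A.Chamber := by
  obtain ⟨x, hx⟩ := A.exists_mem_complement
  exact ⟨A.chamberOf hx⟩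

variable [IsTopologicalAddGroup V] [ContinuousSMul ℝ V]

theorem isEmpty_realization {A : CentralArrangement V} [IsEmpty A.hyperplanes] :
    IsEmpty (Realization A.M) :=
  ⟨fun w => by
    obtain ⟨w, s, ⟨-, H, -⟩, -⟩ := w
    exact isEmptyElim H⟩

theorem induced_induced_of_leftInverse {A : CentralArrangement V} {f g : A.Chamber → A.Chamber}
    (hf : A.IIA f) (hg : A.IIA g) (h : Function.LeftInverse g f) (w : Realization A.M) :
    hg.induced (hf.induced w) = w := by
  apply Subtype.ext
  change stdSimplex.map g (stdSimplex.map f w.1) = w.1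
  rw [stdSimplex.map_comp_apply, Function.LeftInverse.comp_eq_id h, stdSimplex.map_id_apply]

theorem not_nullhomotopic_of_hasDegree {A : CentralArrangement V}
    {g : C(Realization A.M, Realization A.M)}
    (hg : HasDegree A.rank g 1 ∨ HasDegree A.rank g (-1)) : ¬ g.Nullhomotopic := by
  intro hnull
  rcases hr : A.rank with _ | n
  · rw [hr] at hg
    have : IsEmpty (Realization A.M) := hg.elim (fun h => h.1) fun h => h.1
    exact isEmptyElim hnull.choose
  · rw [hr] at hg
    have hzero : ∀ x ∈ reducedHomology n (Realization A.M), x = 0 := by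
      intro x hx
      have h0 := SingularChain.singularHomologyMap_eq_zero_of_nullhomotopic hnull hx
      rcases hg with h | h
      · have := h.2 x hx
        rw [h0, one_smul] at this
        exact this.symm
      · have := (h.2 x hx).trans (neg_one_zsmul x)
        rw [h0] at this
        exact neg_eq_zero.1 this.symm
    have he : Nonempty (reducedHomology n (Realization A.M) ≃ₗ[ℤ] ℤ) :=
      hg.elim (fun h => h.1) fun h => h.1
    obtain ⟨e⟩ := he
    have h1 : e.symm 1 = 0 := Subtype.ext (hzero _ (e.symm 1).2)
    have h2 : (1 : ℤ) = 0 := by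
      rw [← e.apply_symm_apply 1, h1, map_zero]
    exact one_ne_zero h2

variable [FiniteDimensional ℝ V] [T2Space V]

theorem chamber_eq_of_eps_eq {A : CentralArrangement V} {c d : A.Chamber}
    (h : ∀ H, A.eps H c = A.eps H d) : c = d :=
  A.chamber_eq_of_chamberSign_eq fun H => (A.eps_eq_iff H c d).1 (h H)

open Classical in
/-- The chamber `c` as a vertex of `|M₁(A)|`. The hyperplane `H` witnesses that `{c}` is a face, since
`M₁(∅)` has no vertices. -/
def vertex (A : CentralArrangement V) (H : A.hyperplanes) (c : A.Chamber) : Realization A.M :=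
  ⟨stdSimplex.vertex c, A.halfFace H c, A.halfFace_mem_faces H c, fun d hd => by
    rw [stdSimplex.vertex_coe]
    refine Pi.single_eq_of_ne ?_ _
    rintro rfl
    exact hd (A.mem_halfFace.2 rfl)⟩

theorem vertex_apply_eq_zero {A : CentralArrangement V} {H : A.hyperplanes} {c d : A.Chamber}
    (h : d ≠ c) : (A.vertex H c).1 d = 0 := by
  classical
  exact Pi.single_eq_of_ne h _

theorem vertex_injective (A : CentralArrangement V) (H : A.hyperplanes) :
    Function.Injective (A.vertex H) := by
  classical
  intro c d h
  exact stdSimplex.vertex_injective (congrArg Subtype.val h)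

variable {A : CentralArrangement V} {f : A.Chamber → A.Chamber}

theorem IIA.induced_vertex (hf : A.IIA f) (H : A.hyperplanes) (c : A.Chamber) :
    hf.induced (A.vertex H c) = A.vertex H (f c) := by
  classical
  apply Subtype.ext
  exact stdSimplex.map_vertex f c

theorem eq_id_or_isSwap_or_const {H : A.hyperplanes}
    (φ : (A.single H).Chamber → (A.single H).Chamber) :
    φ = id ∨ IsSwap φ ∨ ∃ e, ∀ x, φ x = e := by
  obtain ⟨c⟩ := A.nonempty_chamber
  have hne := A.eps_opposite_ne H c
  have hall := A.eq_eps_or_eq_eps_opposite H c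
  generalize A.eps H c = a at hne hall
  generalize A.eps H (A.opposite c) = b at hne hall
  rcases hall (φ a) with ha | ha <;> rcases hall (φ b) with hb | hb
  · refine Or.inr (Or.inr ⟨a, fun x => ?_⟩)
    rcases hall x with rfl | rfl <;> assumption
  · refine Or.inl (funext fun x => ?_)
    rcases hall x with rfl | rfl <;> assumption
  · exact Or.inr (Or.inl ⟨a, b, hne.symm, hall, ha, hb⟩)
  · refine Or.inr (Or.inr ⟨b, fun x => ?_⟩)
    rcases hall x with rfl | rfl <;> assumption

theorem Intertwines.eq_id_or_isSwap_of_surjective {H : A.hyperplanes}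
    {φ : (A.single H).Chamber → (A.single H).Chamber} (hφ : A.Intertwines f H φ)
    (hf : Function.Surjective f) : φ = id ∨ IsSwap φ := by
  rcases eq_id_or_isSwap_or_const φ with h | h | ⟨e, he⟩
  · exact Or.inl h
  · exact Or.inr h
  · obtain ⟨c⟩ := A.nonempty_chamber
    obtain ⟨c₁, hc₁⟩ := hf c
    obtain ⟨c₂, hc₂⟩ := hf (A.opposite c)
    refine absurd ?_ (A.eps_opposite_ne H c)
    rw [← hc₂, hφ, he, ← hc₁, hφ, he]

/-- If `φ` is constant, then the image of `f` lies in one face, and the induced map contracts to a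
vertex of that face along straight lines. -/
theorem Intertwines.eq_id_or_isSwap_of_not_nullhomotopic {H : A.hyperplanes}
    {φ : (A.single H).Chamber → (A.single H).Chamber} (hφ : A.Intertwines f H φ) (hf : A.IIA f)
    (hnull : ¬ hf.induced.Nullhomotopic) : φ = id ∨ IsSwap φ := by
  rcases eq_id_or_isSwap_or_const φ with h | h | ⟨e, he⟩
  · exact Or.inl h
  · exact Or.inr h
  · obtain ⟨c⟩ := A.nonempty_chamber
    refine absurd ⟨A.vertex H (f c), Realization.homotopic_of_forall_face _ _ fun w =>
      ⟨A.halfFace H (f c), A.halfFace_mem_faces H (f c), fun d hd => ?_, fun d hd => ?_⟩⟩ hnull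
    · refine hf.isSimplicial.realize_apply_eq_zero w fun i hi => hd ?_
      rw [mem_halfFace, ← eps_eq_iff, ← hi, hφ, hφ, he, he]
    · refine vertex_apply_eq_zero (H := H) fun h => hd ?_
      rw [h, mem_halfFace]

variable {φ : (H : A.hyperplanes) → (A.single H).Chamber → (A.single H).Chamber}

theorem injective_of_forall_involutive (hφ : ∀ H, A.Intertwines f H (φ H))
    (h : ∀ H, Function.Involutive (φ H)) : Function.Injective f := by
  intro c d hcd
  refine chamber_eq_of_eps_eq fun H => (h H).injective ?_
  rw [← hφ, ← hφ, hcd]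

/-- The inverse of `f` satisfies IIA with the same maps `φ H`, since these are involutions. -/
theorem IIA.isHomeomorph_induced (hf : A.IIA f) (hφ : ∀ H, A.Intertwines f H (φ H))
    (h : ∀ H, Function.Involutive (φ H)) : IsHomeomorph hf.induced := by
  let e := Equiv.ofBijective f
    (Finite.injective_iff_bijective.1 (injective_of_forall_involutive hφ h))
  have he : ∀ c, f (e.symm c) = c := e.apply_symm_apply
  have hg : A.IIA e.symm := fun H => ⟨φ H, fun c => by
    rw [← h H (A.eps H (e.symm c)), ← hφ, he]⟩
  let E : Realization A.M ≃ₜ Realization A.M :=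
    { toFun := hf.induced
      invFun := hg.induced
      left_inv := induced_induced_of_leftInverse hf hg e.left_inv
      right_inv := induced_induced_of_leftInverse hg hf e.right_inv
      continuous_toFun := hf.induced.continuous
      continuous_invFun := hg.induced.continuous }
  exact E.isHomeomorph

theorem IIA.injective_of_injective_induced (hf : A.IIA f)
    (h : Function.Injective hf.induced) : Function.Injective f := by
  intro c d hcd
  rcases isEmpty_or_nonempty A.hyperplanes with hA | ⟨⟨H⟩⟩
  · exact chamber_eq_of_eps_eq fun H => isEmptyElim H
  · apply A.vertex_injective H
    apply h
    rw [hf.induced_vertex, hf.induced_vertex, hcd]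

theorem hasDegree_one_or_neg_one_of_isHomeomorph
    {g : C(Realization A.M, Realization A.M)} (hg : IsHomeomorph g) :
    HasDegree A.rank g 1 ∨ HasDegree A.rank g (-1) := by
  rcases hr : A.rank with _ | n
  · have := isEmpty_hyperplanes_of_rank_eq_zero hr
    exact Or.inl ⟨isEmpty_realization, rfl⟩
  · obtain ⟨e⟩ := A.nonempty_reducedHomology_realization_equiv hr
    let T := SingularChain.reducedHomologyEquiv n (hg.homeomorph g).toHomotopyEquiv
    have hT : ∀ x, (T x).1 = singularHomologyMap n g x.1 := fun x => rfl
    refine (Int.addEquiv_apply_eq_or e T).imp (fun h => ⟨⟨e.toIntLinearEquiv⟩, fun x hx => ?_⟩)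
      fun h => ⟨⟨e.toIntLinearEquiv⟩, fun x hx => ?_⟩
    · rw [← hT ⟨x, hx⟩, h, one_smul]
    · rw [← hT ⟨x, hx⟩, h]
      exact (neg_one_zsmul x).symm

end CentralArrangement

theorem lemma2 {V : Type*} [AddCommGroup V] [Module ℝ V] [FiniteDimensional ℝ V]
    [TopologicalSpace V] [IsTopologicalAddGroup V] [ContinuousSMul ℝ V] [T2Space V]
    (A : CentralArrangement V) (f : A.Chamber → A.Chamber) (hf : A.IIA f)
    (φ : (H : A.hyperplanes) → (A.single H).Chamber → (A.single H).Chamber)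
    (hφ : ∀ H : A.hyperplanes, A.Intertwines f H (φ H)) :
    List.TFAE [
      Function.Injective f,
      ∀ H : A.hyperplanes, φ H = id ∨ IsSwap (φ H),
      ¬ hf.induced.Nullhomotopic,
      HasDegree A.rank hf.induced 1 ∨ HasDegree A.rank hf.induced (-1),
      IsHomeomorph hf.induced] ∧
    (Function.Injective f → (∃ c, f c = c) → f = id) := by
  have h12 : Function.Injective f → ∀ H : A.hyperplanes, φ H = id ∨ IsSwap (φ H) := fun h H =>
    (hφ H).eq_id_or_isSwap_of_surjective (Finite.injective_iff_surjective.1 h)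
  refine ⟨?_, fun h ⟨c, hc⟩ => funext fun d => ?_⟩
  · tfae_have 1 → 2 := h12
    tfae_have 2 → 5 := fun h =>
      hf.isHomeomorph_induced hφ fun H => involutive_of_eq_id_or_isSwap (h H)
    tfae_have 5 → 1 := fun h => hf.injective_of_injective_induced h.injective
    tfae_have 5 → 4 := CentralArrangement.hasDegree_one_or_neg_one_of_isHomeomorph
    tfae_have 4 → 3 := CentralArrangement.not_nullhomotopic_of_hasDegree
    tfae_have 3 → 2 := fun h H => (hφ H).eq_id_or_isSwap_of_not_nullhomotopic hf h
    tfae_finish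
  · refine CentralArrangement.chamber_eq_of_eps_eq fun H => ?_
    have hid : φ H = id := (h12 h H).resolve_right fun hs =>
      hs.apply_ne (A.eps H c) (by rw [← hφ, hc])
    rw [hφ, hid]
    rfl

end
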